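/- For $j\in\mathbb N$ let $\Lambda_j=[-j,j]^4\cap\mathbb Z^4$, with set of (positively oriented) nearest-neighbour edges $E(\Lambda_j)$ and set of (positively oriented) plaquettes $F(\Lambda_j)$; write $(\mathrm d\theta)(f)=\sum_{e\in f}\theta(e)$ for the signed sum of $\theta$ over the four oriented boundary edges of the plaquette $f$. For $\beta>0$ let $$Z^{\mathrm{Vil}}_{\beta,\Lambda_j}=\int_{[-\pi,\pi)^{E}}\ \prod_{f\in F}\ \sum_{m\in\mathbb Z}\exp\Big(-\frac{\beta}{2}\big(2\pi m+(\mathrm d\theta)(f)\big)^2\Big)\,d\theta$$ be the partition function of the Villain $U(1)$ lattice gauge theory, where $d\theta$ is Lebesgue measure, and where $E=E(\Lambda_j)$, $F=F(\Lambda_j)$ for free boundary conditions, while for zero boundary conditions $E$ and $F$ consist of the edges and plaquettes of $\Lambda_j$ that are not contained in the boundary of the cube $[-j,j]^4$, and $\theta$ is set equal to $0$ on the edges contained in the boundary. Then for every $\delta>0$ there exists $\beta_0>0$ such that for every $\beta>\beta_0$ and for either free or zero boundary conditions, $Z^{\mathrm{Vil}}_{\beta,\Lambda_j}$ is positive and $\ln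 Z^{\mathrm{Vil}}_{\cdot,\Lambda_j}$ is differentiable at $\beta$ for all $j$, and $$\limsup_{j\to\infty}\ \frac{1}{4(2j)^4}\,\frac{\partial}{\partial\beta}\ln Z^{\mathrm{Vil}}_{\beta,\Lambda_j}\ \le\ -\frac34\left(\frac1{2\beta}+\frac12\,e^{-\pi^2(\beta+\delta)}\right).$$ -/

import Mathlib

namespace VillainGauge

/-- An edge of `ℤ⁴` with its positive orientation: `(x, μ)` is the edge from `x` to `x + e_μ`. -/
abbrev Edge : Type := (Fin 4 → ℤ) × Fin 4

/-- A plaquette (2-cell) of `ℤ⁴`: for `μ < ν`, `(x, μ, ν)` is the unit square with corners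
`x`, `x + e_μ`, `x + e_μ + e_ν`, `x + e_ν`, with its positive orientation. -/
abbrev Plaquette : Type := (Fin 4 → ℤ) × Fin 4 × Fin 4

/-- The `μ`-th vector of the canonical basis of `ℤ⁴`. -/
def unitVec (μ : Fin 4) : Fin 4 → ℤ := Pi.single μ 1

/-- The vertices of the box `[-j, j]⁴ ∩ ℤ⁴`. -/
noncomputable def boxVertices (j : ℕ) : Finset (Fin 4 → ℤ) :=
  Fintype.piFinset fun _ => Finset.Icc (-(j : ℤ)) (j : ℤ)

/-- The (non-oriented) edges of the box. -/
noncomputable def boxEdges (j : ℕ) : Finset Edge :=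
  (boxVertices j ×ˢ (Finset.univ : Finset (Fin 4))).filter fun e =>
    e.1 + unitVec e.2 ∈ boxVertices j

/-- The (non-oriented) plaquettes of the box. -/
noncomputable def boxPlaquettes (j : ℕ) : Finset Plaquette :=
  (boxVertices j ×ˢ (Finset.univ : Finset (Fin 4 × Fin 4))).filter fun f =>
    f.2.1 < f.2.2 ∧ f.1 + unitVec f.2.1 + unitVec f.2.2 ∈ boxVertices j

/-- The whole edge lies in the boundary of the cube `[-j, j]⁴`, that is, in one of its facets:
a coordinate that is constant along the edge equals `j` or `-j`. -/
def EdgeOnBoundary (j : ℕ) (e : Edge) : Prop :=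
  ∃ i : Fin 4, i ≠ e.2 ∧ |e.1 i| = (j : ℤ)

/-- The whole plaquette lies in the boundary of the cube `[-j, j]⁴`, that is, in one of its
facets: a coordinate that is constant on the plaquette equals `j` or `-j`. -/
def PlaquetteOnBoundary (j : ℕ) (f : Plaquette) : Prop :=
  ∃ i : Fin 4, i ≠ f.2.1 ∧ i ≠ f.2.2 ∧ |f.1 i| = (j : ℤ)

instance (j : ℕ) : DecidablePred (EdgeOnBoundary j) := fun e => by
  unfold EdgeOnBoundary; infer_instance

instance (j : ℕ) : DecidablePred (PlaquetteOnBoundary j) := fun f => by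
  unfold PlaquetteOnBoundary; infer_instance

/-- The two boundary conditions. -/
inductive BoundaryCondition : Type
  | free
  | zero

/-- The edges carrying a free variable: all edges of the box for free boundary conditions, the
edges that do not lie in the boundary for zero boundary conditions. -/
noncomputable def edges (bc : BoundaryCondition) (j : ℕ) : Finset Edge :=
  match bc with
  | .free => boxEdges j
  | .zero => (boxEdges j).filter fun e => ¬ EdgeOnBoundary j e

/-- The plaquettes carrying an integer variable `m`: all plaquettes of the box for free boundary
conditions, those that do not lie in the boundary for zero boundary conditions (where the integer
2-form `m` vanishes on the boundary plaquettes, just as `dθ` does, so that these have weight 1). -/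
noncomputable def plaquettes (bc : BoundaryCondition) (j : ℕ) : Finset Plaquette :=
  match bc with
  | .free => boxPlaquettes j
  | .zero => (boxPlaquettes j).filter fun f => ¬ PlaquetteOnBoundary j f

/-- The value at an arbitrary positively oriented edge of the 1-form with free variables `θ`; it
is `0` at every edge without a variable (which, inside the box, are the boundary edges for zero
boundary conditions, and none for free boundary conditions). -/
noncomputable def oneForm (bc : BoundaryCondition) (j : ℕ) (θ : edges bc j → ℝ) (e : Edge) : ℝ :=
  if h : e ∈ edges bc j then θ ⟨e, h⟩ else 0

/-- The discrete exterior derivative of a 1-form: the sum of its values over the four oriented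
edges of the boundary of a positively oriented plaquette. -/
def extDeriv (a : Edge → ℝ) (f : Plaquette) : ℝ :=
  a (f.1, f.2.1) + a (f.1 + unitVec f.2.1, f.2.2)
    - a (f.1 + unitVec f.2.2, f.2.1) - a (f.1, f.2.2)

/-- The Villain weight `∑_{m ∈ ℤ} exp (-(β/2) (2πm + t)²)`. -/
noncomputable def villainWeight (β t : ℝ) : ℝ :=
  ∑' m : ℤ, Real.exp (-(β / 2) * (2 * Real.pi * (m : ℝ) + t) ^ 2)

/-- The partition function `Z^{Vil}_{β, Λ_j}` of the Villain `U(1)` lattice gauge theory on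
`Λ_j = [-j, j]⁴ ∩ ℤ⁴`: an integral with respect to Lebesgue measure over the cube `[-π, π)^E`. -/
noncomputable def partitionFunction (bc : BoundaryCondition) (j : ℕ) (β : ℝ) : ℝ :=
  ∫ θ in Set.univ.pi (fun _ : edges bc j => Set.Ico (-Real.pi) Real.pi),
    ∏ f ∈ plaquettes bc j, villainWeight β (extDeriv (oneForm bc j θ) f)

end VillainGauge

/-!
Write `E` and `F` for the edges and plaquettes, `V = range d ⊆ ℝ^F`, and `P` for the orthogonal
projection onto `V`. Let `ν` be the image of Lebesgue measure on `[-π, π)^E` times counting measure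
on `ℤ^F` under `(θ, m) ↦ ω = 2πm + dθ` (`fluxMeasure`). Then `Z(β) = ∫ exp (-(β/2) ‖ω‖²) dν`, so
that `-∂ ln Z = ½ ⟨‖ω‖²⟩`. The measure `ν` is invariant under translations by `V`, because
`θ ↦ ∑ₘ G (2πm + dθ)` is `2π`-periodic, and under translations by `2πℤ^F`.

* Along `V` the field `ω` is therefore Gaussian, and contributes `rank d / β` to `⟨‖ω‖²⟩`
  (`integral_inner_sq_mul_gaussWeight`).
* The orthogonal part of `ω` has the coordinates `⟪ω, u_f⟫` with `u_f = δ_f - P δ_f`, and `ν` is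
  invariant under translation by `2πu_f`. Comparing the Gaussian weights at `ω` and `ω ± 2πu_f`
  gives `⟨⟪ω, u_f⟫²⟩ ≥ (π²/3) a_f² exp (-2π²β a_f)`, where `a_f = ‖u_f‖²`
  (`le_integral_inner_sq_mul_gaussWeight`).

It remains to know that, up to boundary terms, `rank d` is half the number `6 (2j)⁴` of plaquettes
and `a_f ≈ 1/2`. The rank is bounded below by axial gauge fixing and above by exhibiting gradients
in the kernel of `d`. Since `∑ (1 - a_f) = rank d`, the average of `a_f` tends to `1/2`, so in some
large box with zero boundary conditions some plaquette has `a_f ≤ 1/2 + ε` (`exists_defect_le`). The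
`1`-form which witnesses this has finite support, so the symmetries of `ℤ⁴` carry it to every
plaquette far from the boundary (`exists_norm_single_sub_extMap_sq_le`). With `ε = δ / (2β)` the
exponential is at least `exp (-π²(β + δ))` there, and `a² ≥ a - 1/4` gives `∑ a_f² ≥ (1/4) |F|` up
to boundary terms. In total the limit superior is at most
`-(3/(8β) + (π²/16) exp (-π²(β + δ)))`.
-/

namespace VillainGauge

open MeasureTheory ProbabilityTheory Filter Topology
open scoped RealInnerProductSpace ENNReal

/-! ### Second moments under invariant measures with a Gaussian weight -/

section GaussianWeight

variable {H : Type*} [NormedAddCommGroup H]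

/-- The Gaussian weight `exp (-(β/2) ‖ω‖²)`. -/
noncomputable def gaussWeight (β : ℝ) (ω : H) : ℝ := Real.exp (-(β / 2) * ‖ω‖ ^ 2)

lemma gaussWeight_pos (β : ℝ) (ω : H) : 0 < gaussWeight β ω := Real.exp_pos _

lemma continuous_gaussWeight (β : ℝ) : Continuous (gaussWeight β : H → ℝ) := by
  unfold gaussWeight; fun_prop

lemma gaussWeight_add [InnerProductSpace ℝ H] (β : ℝ) (ω w : H) :
    gaussWeight β (ω + w) =
      Real.exp (-(β / 2) * (2 * ⟪ω, w⟫ + ‖w‖ ^ 2)) * gaussWeight β ω := by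
  rw [gaussWeight, gaussWeight, ← Real.exp_add, norm_add_sq_real]
  congr 1; ring

variable [MeasurableSpace H] {ν : Measure H}

lemma neg_mem_interior_integrableExpSet
    (hν : ∀ b : ℝ, 0 < b → Integrable (gaussWeight b) ν) {β : ℝ} (hβ : 0 < β) :
    -(β / 2) ∈ interior (integrableExpSet (fun ω : H => ‖ω‖ ^ 2) ν) := by
  rw [mem_interior]
  refine ⟨Set.Iio 0, fun t ht => ?_, isOpen_Iio, by simpa using hβ⟩
  have ht' : t < 0 := ht
  have := hν (-2 * t) (by linarith)
  refine this.congr (Eventually.of_forall fun ω => ?_)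
  simp only [gaussWeight]
  congr 2; ring

lemma hasDerivAt_integral_gaussWeight
    (hν : ∀ b : ℝ, 0 < b → Integrable (gaussWeight b) ν) {β : ℝ} (hβ : 0 < β) :
    HasDerivAt (fun b : ℝ => ∫ ω, gaussWeight b ω ∂ν)
      (-(1 / 2) * ∫ ω, ‖ω‖ ^ 2 * gaussWeight β ω ∂ν) β := by
  have h := hasDerivAt_mgf (neg_mem_interior_integrableExpSet hν hβ)
  have h2 : HasDerivAt (fun b : ℝ => -(b / 2)) (-(1 / 2)) β :=
    ((hasDerivAt_id β).div_const 2).neg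
  have h3 := h.comp β h2
  rw [mul_comm] at h3
  exact h3

lemma integrable_norm_sq_mul_gaussWeight
    (hν : ∀ b : ℝ, 0 < b → Integrable (gaussWeight b) ν) {β : ℝ} (hβ : 0 < β) :
    Integrable (fun ω => ‖ω‖ ^ 2 * gaussWeight β ω) ν := by
  have := integrable_pow_mul_exp_of_mem_interior_integrableExpSet
    (neg_mem_interior_integrableExpSet hν hβ) 1
  simpa [gaussWeight] using this

variable [InnerProductSpace ℝ H] [BorelSpace H]

lemma integrable_inner_sq_mul_gaussWeight
    (hν : ∀ b : ℝ, 0 < b → Integrable (gaussWeight b) ν) {β : ℝ} (hβ : 0 < β) (w : H) :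
    Integrable (fun ω => ⟪ω, w⟫ ^ 2 * gaussWeight β ω) ν := by
  have h := (integrable_norm_sq_mul_gaussWeight hν hβ).const_mul (‖w‖ ^ 2)
  refine h.mono ?_ (Eventually.of_forall fun ω => ?_)
  · refine AEStronglyMeasurable.mul ?_ (hν β hβ).aestronglyMeasurable
    have h1 : AEMeasurable (fun ω : H => ⟪ω, w⟫) ν := by
      exact (Continuous.measurable (by fun_prop)).aemeasurable
    exact (h1.pow_const 2).aestronglyMeasurable
  · have := gaussWeight_pos β ω
    have h1 : ⟪ω, w⟫ ^ 2 ≤ ‖w‖ ^ 2 * ‖ω‖ ^ 2 := by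
      have := sq_le_sq' (neg_le_of_abs_le (abs_real_inner_le_norm ω w))
        (le_of_abs_le (abs_real_inner_le_norm ω w))
      nlinarith
    rw [Real.norm_of_nonneg (by positivity), Real.norm_of_nonneg (by positivity), ← mul_assoc]
    gcongr

/-- If `ν` is invariant under translations along the line `ℝ w`, then `⟪ω, w⟫` is a centred
Gaussian of variance `‖w‖² / β` under `gaussWeight β • ν`: translating by `(s / β) w` computes its
moment generating function. -/
lemma integral_inner_sq_mul_gaussWeight
    (hν : ∀ b : ℝ, 0 < b → Integrable (gaussWeight b) ν) {β : ℝ} (hβ : 0 < β) (w : H)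
    (hw : ∀ s : ℝ, MeasurePreserving (fun ω => ω + s • w) ν ν) :
    ∫ ω, ⟪ω, w⟫ ^ 2 * gaussWeight β ω ∂ν = ‖w‖ ^ 2 / β * ∫ ω, gaussWeight β ω ∂ν := by
  set ρ : Measure H := ν.withDensity fun ω => ENNReal.ofReal (gaussWeight β ω) with hρ
  have hmeas : Measurable (gaussWeight β : H → ℝ) := (continuous_gaussWeight β).measurable
  have hint : ∀ g : H → ℝ, ∫ ω, g ω ∂ρ = ∫ ω, g ω * gaussWeight β ω ∂ν := by
    intro g
    rw [hρ, integral_withDensity_eq_integral_toReal_smul hmeas.ennreal_ofReal (by simp)]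
    congr 1; ext ω
    rw [ENNReal.toReal_ofReal (gaussWeight_pos β ω).le, smul_eq_mul, mul_comm]
  have hinteg : ∀ g : H → ℝ, Integrable (fun ω => g ω * gaussWeight β ω) ν → Integrable g ρ := by
    intro g hg
    rw [hρ, integrable_withDensity_iff hmeas.ennreal_ofReal (by simp)]
    refine hg.congr (Eventually.of_forall fun ω => ?_)
    simp [ENNReal.toReal_ofReal (gaussWeight_pos β ω).le]
  have hshift : ∀ (s : ℝ) (ω : H), Real.exp (s * ⟪ω, w⟫) * gaussWeight β ω =
      Real.exp (s ^ 2 * ‖w‖ ^ 2 / (2 * β)) * gaussWeight β (ω + (-(s / β)) • w) := by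
    intro s ω
    rw [gaussWeight_add, ← mul_assoc, ← Real.exp_add, inner_smul_right, norm_smul]
    congr 2
    rw [mul_pow, Real.norm_eq_abs, sq_abs]
    field_simp
    ring
  have hall : ∀ s : ℝ, Integrable (fun ω => Real.exp (s * ⟪ω, w⟫)) ρ := by
    intro s
    apply hinteg
    simp_rw [hshift]
    exact (((hw (-(s / β))).integrable_comp (hν β hβ).aestronglyMeasurable).2 (hν β hβ)).const_mul _
  have hemb : ∀ s : ℝ, MeasurableEmbedding (fun ω : H => ω + s • w) := fun s =>
    (Homeomorph.addRight (s • w)).measurableEmbedding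
  have hmgf : mgf (fun ω => ⟪ω, w⟫) ρ = fun s =>
      Real.exp (s ^ 2 * (‖w‖ ^ 2 / (2 * β))) * ∫ ω, gaussWeight β ω ∂ν := by
    ext s
    rw [mgf, hint]
    simp_rw [hshift]
    rw [integral_const_mul, (hw (-(s / β))).integral_comp (hemb _)]
    congr 2; ring
  have hset : integrableExpSet (fun ω => ⟪ω, w⟫) ρ = Set.univ :=
    Set.eq_univ_of_forall hall
  have h2 := iteratedDeriv_mgf_zero (X := fun ω => ⟪ω, w⟫) (μ := ρ) (by simp [hset]) 2
  rw [hint] at h2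
  simp only [Pi.pow_apply] at h2
  rw [← h2, hmgf]
  set c := ‖w‖ ^ 2 / (2 * β) with hc
  set Z := ∫ ω, gaussWeight β ω ∂ν
  have d1 : deriv (fun s : ℝ => Real.exp (s ^ 2 * c) * Z) =
      fun s => Real.exp (s ^ 2 * c) * (2 * s * c) * Z := by
    ext s
    have : HasDerivAt (fun s : ℝ => Real.exp (s ^ 2 * c) * Z)
        (Real.exp (s ^ 2 * c) * (2 * s * c) * Z) s := by
      have := (((hasDerivAt_pow 2 s).mul_const c).exp).mul_const Z
      simpa using this
    exact this.deriv
  rw [iteratedDeriv_succ, iteratedDeriv_one, d1]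
  have d2 : HasDerivAt (fun s : ℝ => Real.exp (s ^ 2 * c) * (2 * s * c) * Z) (2 * c * Z) 0 := by
    have e1 := ((hasDerivAt_pow 2 (0 : ℝ)).mul_const c).exp
    have e2 := ((hasDerivAt_id (0 : ℝ)).const_mul 2).mul_const c
    have := (e1.mul e2).mul_const Z
    simpa using this
  rw [d2.deriv, hc]
  field_simp

/-- If `ν` is invariant under translation by `2πw`, then `⟪ω, w⟫` fluctuates under
`gaussWeight β • ν`: comparing the weight at `ω` with the weights at `ω ± 2πw` shows that
`⟪ω, w⟫` cannot be concentrated near `0`. -/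
lemma le_integral_inner_sq_mul_gaussWeight
    (hν : ∀ b : ℝ, 0 < b → Integrable (gaussWeight b) ν) {β : ℝ} (hβ : 0 < β) (w : H)
    (hw : MeasurePreserving (fun ω => ω + (2 * Real.pi) • w) ν ν) :
    Real.pi ^ 2 / 3 * (‖w‖ ^ 2) ^ 2 * Real.exp (-(2 * Real.pi ^ 2 * β * ‖w‖ ^ 2)) *
      ∫ ω, gaussWeight β ω ∂ν ≤ ∫ ω, ⟪ω, w⟫ ^ 2 * gaussWeight β ω ∂ν := by
  set a := ‖w‖ ^ 2 with ha
  have ha0 : 0 ≤ a := by positivity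
  set b := 2 * Real.pi ^ 2 * β * a with hb
  have hb0 : 0 ≤ b := by positivity
  set q : ℝ := 2 * Real.pi with hq
  have hq0 : 0 < q := by positivity
  set g : H → ℝ := fun ω => ⟪ω, w⟫ ^ 2 * gaussWeight β ω with hg
  have hgint : Integrable g ν := integrable_inner_sq_mul_gaussWeight hν hβ w
  have hemb : ∀ z : H, MeasurableEmbedding (fun ω : H => ω + z) := fun z =>
    (Homeomorph.addRight z).measurableEmbedding
  have hw' : MeasurePreserving (fun ω => ω + -(q • w)) ν ν := by
    have := hw.symm (Homeomorph.addRight (q • w)).toMeasurableEquiv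
    convert! this using 1
  have hgn : ∀ ω, 0 ≤ g ω := fun ω => mul_nonneg (sq_nonneg _) (gaussWeight_pos β ω).le
  have hww : ⟪w, w⟫ = a := by rw [real_inner_self_eq_norm_sq]
  have hgp : ∀ ω, g (ω + q • w) = (⟪ω, w⟫ + q * a) ^ 2 *
      (Real.exp (-(β * q / 2) * (2 * ⟪ω, w⟫ + q * a)) * gaussWeight β ω) := by
    intro ω
    simp only [hg, gaussWeight_add, inner_add_left, inner_smul_left, inner_smul_right, norm_smul,
      hww, mul_pow, Real.norm_eq_abs, sq_abs, ← ha, RCLike.conj_to_real]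
    congr 3; ring
  have hgm : ∀ ω, g (ω + -(q • w)) = (⟪ω, w⟫ - q * a) ^ 2 *
      (Real.exp (-(β * q / 2) * (-2 * ⟪ω, w⟫ + q * a)) * gaussWeight β ω) := by
    intro ω
    simp only [hg, gaussWeight_add, inner_add_left, inner_neg_left, inner_neg_right, norm_neg,
      inner_smul_left, inner_smul_right, norm_smul,
      hww, mul_pow, Real.norm_eq_abs, sq_abs, ← ha, RCLike.conj_to_real]
    congr 3; ring
  have hbq : b = β * q * (q * a) / 2 := by rw [hb, hq]; ring
  have key : ∀ ω, (q * a) ^ 2 * gaussWeight β ω ≤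
      4 * Real.exp b * (g ω + (g (ω + q • w) + g (ω + -(q • w)))) := by
    intro ω
    have hW := gaussWeight_pos β ω
    have n1 := hgn ω
    have n2 := hgn (ω + q • w)
    have n3 := hgn (ω + -(q • w))
    have hqa : 0 ≤ q * a := by positivity
    set X := ⟪ω, w⟫ with hX
    -- whichever of `ω`, `ω ± 2πw` has `|⟪·, w⟫| ≥ πa` carries the estimate
    have finish : ∀ (Y t : ℝ), (q * a / 2) ^ 2 ≤ Y ^ 2 → -b ≤ t →
        (q * a) ^ 2 * gaussWeight β ω ≤ 4 * Real.exp b * (Y ^ 2 * (Real.exp t * gaussWeight β ω)) := by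
      intro Y t hY ht
      have h1 : 1 ≤ Real.exp b * Real.exp t := by
        rw [← Real.exp_add]; exact Real.one_le_exp (by linarith)
      have h2 : (q * a) ^ 2 ≤ 4 * Y ^ 2 := by nlinarith
      calc (q * a) ^ 2 * gaussWeight β ω ≤ 4 * Y ^ 2 * gaussWeight β ω := by gcongr
        _ ≤ 4 * Y ^ 2 * gaussWeight β ω * (Real.exp b * Real.exp t) :=
            le_mul_of_one_le_right (by positivity) h1
        _ = _ := by ring
    have hE : 0 < 4 * Real.exp b := by positivity
    by_cases h1 : (q * a / 2) ^ 2 ≤ X ^ 2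
    · have := finish X 0 h1 (by linarith)
      rw [Real.exp_zero, one_mul] at this
      refine this.trans (mul_le_mul_of_nonneg_left ?_ hE.le)
      change g ω ≤ _
      linarith
    · have h1' : |X| < q * a / 2 := abs_lt_of_sq_lt_sq (not_le.1 h1) (by positivity)
      obtain ⟨h2, h3⟩ := abs_lt.1 h1'
      rcases le_total 0 X with h0 | h0
      · have := finish (X - q * a) (-(β * q / 2) * (-2 * X + q * a)) (by nlinarith)
          (by rw [hbq]; have := mul_nonneg (mul_pos hβ hq0).le h0; nlinarith)
        rw [← hgm] at this
        refine this.trans (mul_le_mul_of_nonneg_left ?_ hE.le)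
        linarith
      · have := finish (X + q * a) (-(β * q / 2) * (2 * X + q * a)) (by nlinarith)
          (by rw [hbq]
              have := mul_nonneg (mul_pos hβ hq0).le (neg_nonneg.2 h0)
              nlinarith)
        rw [← hgp] at this
        refine this.trans (mul_le_mul_of_nonneg_left ?_ hE.le)
        linarith
  have i1 : Integrable (fun ω => g (ω + q • w)) ν :=
    (hw.integrable_comp hgint.aestronglyMeasurable).2 hgint
  have i2 : Integrable (fun ω => g (ω + -(q • w))) ν :=
    (hw'.integrable_comp hgint.aestronglyMeasurable).2 hgint
  have hI := integral_mono ((hν β hβ).const_mul ((q * a) ^ 2))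
    ((hgint.add (i1.add i2)).const_mul (4 * Real.exp b)) key
  simp only [Pi.add_apply] at hI
  have hsum : ∫ ω, (g ω + (g (ω + q • w) + g (ω + -(q • w)))) ∂ν = ∫ ω, g ω ∂ν +
      (∫ ω, g (ω + q • w) ∂ν + ∫ ω, g (ω + -(q • w)) ∂ν) := by
    exact (integral_add hgint (i1.add i2)).trans (congrArg _ (integral_add i1 i2))
  rw [integral_const_mul, integral_const_mul, hsum, hw.integral_comp (hemb _), hw'.integral_comp (hemb _)] at hI
  set Z := ∫ ω, gaussWeight β ω ∂ν
  set G := ∫ ω, g ω ∂ν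
  have e1 : Real.exp (-b) * Real.exp b = 1 := by rw [← Real.exp_add]; simp
  have h5 := mul_le_mul_of_nonneg_left hI (Real.exp_pos (-b)).le
  have h6 : Real.exp (-b) * (4 * Real.exp b * (G + (G + G))) =
      (Real.exp (-b) * Real.exp b) * (12 * G) := by ring
  rw [h6, e1, hq] at h5
  nlinarith

/-- A measure with Gaussian integrability which is invariant under the translations by a subspace
`V` and by `2πe i` for an orthonormal basis `e` has a Gaussian part along `V`, contributing
`dim V / β` to the normalized second moment, and a part along `Vᗮ` whose coordinates are the inner
products with the projections of the `e i`. -/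
lemma le_integral_norm_sq_mul_gaussWeight [FiniteDimensional ℝ H] {ι : Type*} [Fintype ι]
    (hν : ∀ b : ℝ, 0 < b → Integrable (gaussWeight b) ν) {β : ℝ} (hβ : 0 < β)
    (V : Submodule ℝ H) (hV : ∀ v ∈ V, MeasurePreserving (fun ω => ω + v) ν ν)
    (e : OrthonormalBasis ι ℝ H)
    (he : ∀ i, MeasurePreserving (fun ω => ω + (2 * Real.pi) • e i) ν ν) :
    (Module.finrank ℝ V / β + ∑ i, Real.pi ^ 2 / 3 * (‖Vᗮ.starProjection (e i)‖ ^ 2) ^ 2 *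
        Real.exp (-(2 * Real.pi ^ 2 * β * ‖Vᗮ.starProjection (e i)‖ ^ 2))) *
      ∫ ω, gaussWeight β ω ∂ν ≤ ∫ ω, ‖ω‖ ^ 2 * gaussWeight β ω ∂ν := by
  have hdecomp : ∀ ω : H, ‖ω‖ ^ 2 = ∑ i, ⟪ω, (stdOrthonormalBasis ℝ V i : H)⟫ ^ 2 +
      ∑ i, ⟪ω, Vᗮ.starProjection (e i)⟫ ^ 2 := by
    intro ω
    rw [Submodule.norm_sq_eq_add_norm_sq_starProjection ω V]
    congr 1
    · change ‖V.orthogonalProjectionOnto ω‖ ^ 2 = _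
      rw [← (stdOrthonormalBasis ℝ V).sum_sq_inner_right]
      refine Finset.sum_congr rfl fun i _ => ?_
      rw [Submodule.inner_orthogonalProjectionOnto_eq_of_mem_left, real_inner_comm]
    · rw [← e.sum_sq_inner_right]
      refine Finset.sum_congr rfl fun i _ => ?_
      rw [← Submodule.inner_starProjection_left_eq_right, real_inner_comm]
  have h1 : ∫ ω, ‖ω‖ ^ 2 * gaussWeight β ω ∂ν =
      ∑ i, ∫ ω, ⟪ω, (stdOrthonormalBasis ℝ V i : H)⟫ ^ 2 * gaussWeight β ω ∂ν +
      ∑ i, ∫ ω, ⟪ω, Vᗮ.starProjection (e i)⟫ ^ 2 * gaussWeight β ω ∂ν := by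
    simp_rw [hdecomp, add_mul, Finset.sum_mul]
    rw [integral_add, integral_finsetSum, integral_finsetSum]
    · exact fun i _ => integrable_inner_sq_mul_gaussWeight hν hβ _
    · exact fun i _ => integrable_inner_sq_mul_gaussWeight hν hβ _
    · exact integrable_finsetSum _ fun i _ => integrable_inner_sq_mul_gaussWeight hν hβ _
    · exact integrable_finsetSum _ fun i _ => integrable_inner_sq_mul_gaussWeight hν hβ _
  rw [h1, add_mul, Finset.sum_mul]
  refine add_le_add (le_of_eq ?_) (Finset.sum_le_sum fun i _ => ?_)
  · rw [Finset.sum_congr rfl fun i _ => integral_inner_sq_mul_gaussWeight hν hβ _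
      fun s => hV _ (V.smul_mem s (stdOrthonormalBasis ℝ V i).2)]
    simp only [Submodule.norm_coe, OrthonormalBasis.norm_eq_one]
    simp
    ring
  · refine le_integral_inner_sq_mul_gaussWeight hν hβ _ ?_
    -- `2πu` for the projection `u` of a basis vector differs from that vector by one of `V`
    have h2 := (hV (-((2 * Real.pi) • V.starProjection (e i)))
      (V.neg_mem (V.smul_mem _ (V.starProjection_apply_mem _)))).comp (he i)
    convert! h2 using 2 with ω
    rw [Submodule.starProjection_orthogonal_val, smul_sub]
    simp only [Function.comp]
    abel

end GaussianWeight

/-! ### The Villain integral as a Gaussian integral -/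

section FluxMeasure

variable {E F : Type*}

/-- The lattice `2πℤ^E`. -/
noncomputable def twoPiLattice (E : Type*) : AddSubgroup (E → ℝ) :=
  AddMonoidHom.range
    ({ toFun := fun n e => 2 * Real.pi * (n e : ℝ)
       map_zero' := by ext; simp
       map_add' := fun a b => by ext; simp [mul_add] } : (E → ℤ) →+ (E → ℝ))

instance [Fintype E] : Countable (twoPiLattice E) := by
  have : Function.Surjective
      (fun n : E → ℤ => (⟨fun e => 2 * Real.pi * (n e : ℝ), n, rfl⟩ : twoPiLattice E)) := by
    rintro ⟨x, n, rfl⟩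
    exact ⟨n, rfl⟩
  exact this.countable

lemma isAddFundamentalDomain_cube [Fintype E] (a : E → ℝ) :
    IsAddFundamentalDomain (twoPiLattice E)
      (Set.univ.pi fun e => Set.Ico (a e) (a e + 2 * Real.pi)) volume := by
  refine IsAddFundamentalDomain.mk'
    (MeasurableSet.univ_pi fun e => measurableSet_Ico).nullMeasurableSet fun x => ?_
  have h : ∀ e, ∃! n : ℤ, x e + n • (2 * Real.pi) ∈ Set.Ico (a e) (a e + 2 * Real.pi) := fun e =>
    existsUnique_add_zsmul_mem_Ico Real.two_pi_pos (x e) (a e)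
  choose n hn hu using h
  refine ⟨⟨fun e => 2 * Real.pi * (n e : ℝ), n, rfl⟩, ?_, ?_⟩
  · intro e _
    have := hn e
    simp only [zsmul_eq_mul] at this
    change 2 * Real.pi * (n e : ℝ) + x e ∈ _
    rwa [add_comm, mul_comm (2 * Real.pi)]
  · rintro ⟨y, m, rfl⟩ hy
    have hm : m = n := by
      ext e
      apply hu e (m e)
      have : 2 * Real.pi * (m e : ℝ) + x e ∈ _ := hy e (Set.mem_univ e)
      simp only [zsmul_eq_mul]
      rwa [add_comm, mul_comm (2 * Real.pi)] at this
    subst hm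
    rfl

/-- The cube `[-π, π)^E`. -/
def angleCube (E : Type*) : Set (E → ℝ) := Set.univ.pi fun _ => Set.Ico (-Real.pi) Real.pi

lemma measurableSet_angleCube [Fintype E] : MeasurableSet (angleCube E) :=
  MeasurableSet.univ_pi fun _ => measurableSet_Ico

lemma setLIntegral_angleCube_add_right [Fintype E] {g : (E → ℝ) → ℝ≥0∞} (hg : Measurable g)
    (hper : ∀ (n : E → ℤ) (θ : E → ℝ), g ((fun e => 2 * Real.pi * (n e : ℝ)) + θ) = g θ)
    (φ : E → ℝ) : ∫⁻ θ in angleCube E, g (θ + φ) = ∫⁻ θ in angleCube E, g θ := by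
  have h1 : angleCube E = Set.univ.pi fun _ : E => Set.Ico (-Real.pi) (-Real.pi + 2 * Real.pi) := by
    rw [show -Real.pi + 2 * Real.pi = Real.pi by ring]; rfl
  have h2 : angleCube E = (fun θ => θ + φ) ⁻¹'
      (Set.univ.pi fun e : E => Set.Ico (-Real.pi + φ e) (-Real.pi + φ e + 2 * Real.pi)) := by
    ext θ
    simp only [angleCube, Set.mem_pi, Set.mem_univ, true_imp_iff, Set.mem_Ico, Set.mem_preimage,
      Pi.add_apply]
    refine forall_congr' fun e => and_congr ?_ ?_ <;> constructor <;> intro h <;> linarith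
  have hd1 : IsAddFundamentalDomain (twoPiLattice E) (angleCube E) volume :=
    h1 ▸ isAddFundamentalDomain_cube fun _ => -Real.pi
  have hd2 := isAddFundamentalDomain_cube (E := E) fun e => -Real.pi + φ e
  rw [hd1.setLIntegral_eq hd2 g]
  · conv_lhs => rw [h2]
    exact (measurePreserving_add_right volume φ).setLIntegral_comp_preimage
      (MeasurableSet.univ_pi fun e => measurableSet_Ico) hg
  · rintro ⟨_, n, rfl⟩ θ
    exact hper n θ

variable (D : (E → ℝ) →ₗ[ℝ] EuclideanSpace ℝ F)

/-- The vector `2πm + Dθ`. -/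
noncomputable def fluxMap (p : (E → ℝ) × (F → ℤ)) : EuclideanSpace ℝ F :=
  WithLp.toLp 2 (fun f => 2 * Real.pi * (p.2 f : ℝ)) + D p.1

lemma fluxMap_apply (p : (E → ℝ) × (F → ℤ)) (f : F) :
    fluxMap D p f = 2 * Real.pi * (p.2 f : ℝ) + D p.1 f := rfl

lemma gaussWeight_fluxMap [Fintype F] (b : ℝ) (θ : E → ℝ) (m : F → ℤ) :
    gaussWeight b (fluxMap D (θ, m)) =
      ∏ f, Real.exp (-(b / 2) * (2 * Real.pi * (m f : ℝ) + D θ f) ^ 2) := by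
  rw [gaussWeight, ← Real.exp_sum, ← Finset.mul_sum, EuclideanSpace.norm_sq_eq]
  simp [fluxMap_apply]

/-- The summands of the Villain weight are dominated, uniformly for bounded `t`, by a summable
sequence. -/
lemma exists_villainWeight_summand_le {b : ℝ} (hb : 0 < b) (M : ℝ) :
    ∃ c : ℤ → ℝ, Summable c ∧ ∀ t : ℝ, |t| ≤ M → ∀ m : ℤ,
      Real.exp (-(b / 2) * (2 * Real.pi * (m : ℝ) + t) ^ 2) ≤ c m := by
  refine ⟨fun m => Real.exp (b / 2 * M ^ 2) * Real.exp (-(b * Real.pi ^ 2) * (m : ℝ) ^ 2),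
    Summable.mul_left _ ?_, fun t ht m => ?_⟩
  · have hc : 0 < b * Real.pi ^ 2 := by positivity
    have hN : Summable fun n : ℕ => Real.exp (-(b * Real.pi ^ 2) * (n : ℝ) ^ 2) := by
      refine Summable.of_nonneg_of_le (fun n => (Real.exp_pos _).le) (fun n => ?_)
        (Real.summable_exp_nat_mul_iff.2 (neg_lt_zero.2 hc))
      rw [Real.exp_le_exp]
      have : (n : ℝ) ≤ (n : ℝ) ^ 2 := by
        exact_mod_cast Nat.le_self_pow two_ne_zero n
      nlinarith
    refine Summable.of_nat_of_neg ?_ ?_ <;> simpa using hN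
  · beta_reduce
    rw [← Real.exp_add, Real.exp_le_exp]
    have h1 : t ^ 2 ≤ M ^ 2 := sq_le_sq' (by linarith [neg_abs_le t]) ((le_abs_self t).trans ht)
    have h2 : (2 * Real.pi * (m : ℝ)) ^ 2 / 2 - t ^ 2 ≤ (2 * Real.pi * (m : ℝ) + t) ^ 2 := by
      nlinarith [sq_nonneg (2 * Real.pi * (m : ℝ) + 2 * t)]
    nlinarith

lemma integrable_villain_summand {b : ℝ} (hb : 0 < b) (t : ℝ) :
    Integrable (fun m : ℤ => Real.exp (-(b / 2) * (2 * Real.pi * (m : ℝ) + t) ^ 2))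
      Measure.count := by
  obtain ⟨c, hc, h⟩ := exists_villainWeight_summand_le hb |t|
  rw [integrable_count_iff]
  refine Summable.of_nonneg_of_le (fun _ => norm_nonneg _) (fun m => ?_) hc
  rw [Real.norm_of_nonneg (Real.exp_pos _).le]
  exact h t le_rfl m

lemma integral_gaussWeight_fluxMap [Fintype F] {b : ℝ} (hb : 0 < b) (θ : E → ℝ) :
    ∫ m, gaussWeight b (fluxMap D (θ, m)) ∂(Measure.pi fun _ : F => (Measure.count : Measure ℤ)) =
      ∏ f, villainWeight b (D θ f) := by
  simp_rw [gaussWeight_fluxMap]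
  rw [integral_fintype_prod_eq_prod
    (f := fun f (m : ℤ) => Real.exp (-(b / 2) * (2 * Real.pi * (m : ℝ) + D θ f) ^ 2))]
  refine Finset.prod_congr rfl fun f _ => ?_
  rw [villainWeight, integral_countable (integrable_villain_summand hb _)]
  simp

variable [Fintype E] [Fintype F]

lemma measurable_fluxMap : Measurable (fluxMap D) := by
  unfold fluxMap
  refine Measurable.add ?_ ?_
  · refine (WithLp.measurable_toLp 2 _).comp (measurable_pi_lambda _ fun f => ?_)
    refine Measurable.const_mul ?_ _
    exact (measurable_of_countable (fun k : ℤ => (k : ℝ))).comp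
      ((measurable_pi_apply f).comp measurable_snd)
  · exact (LinearMap.continuous_of_finiteDimensional D).measurable.comp measurable_fst

/-- The image of `dθ ⊗ counting measure` on `[-π, π)^E × ℤ^F` under `(θ, m) ↦ 2πm + Dθ`. Integrating
the Gaussian weight against it gives the Villain partition function. -/
noncomputable def fluxMeasure : Measure (EuclideanSpace ℝ F) :=
  Measure.map (fluxMap D)
    ((volume.restrict (angleCube E)).prod (Measure.pi fun _ : F => (Measure.count : Measure ℤ)))

lemma fluxMeasure_ne_zero : fluxMeasure D ≠ 0 := by
  rw [fluxMeasure, Ne, Measure.map_eq_zero_iff (measurable_fluxMap D).aemeasurable]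
  intro h
  have h1 := congrArg (fun μ => μ Set.univ) h
  simp only [← Set.univ_prod_univ, Measure.prod_prod, Measure.coe_zero, Pi.zero_apply,
    mul_eq_zero, Measure.restrict_apply_univ] at h1
  rcases h1 with h1 | h1
  · rw [angleCube, Real.volume_pi_Ico] at h1
    obtain ⟨_, _, h2⟩ := Finset.prod_eq_zero_iff.1 h1
    rw [ENNReal.ofReal_eq_zero] at h2
    linarith [Real.pi_pos]
  · rw [Measure.pi_univ] at h1
    simp at h1

lemma measurePreserving_add_two_pi (k : F → ℤ) :
    MeasurePreserving (fun ω => ω + (2 * Real.pi) • WithLp.toLp 2 fun f => (k f : ℝ))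
      (fluxMeasure D) (fluxMeasure D) := by
  refine ⟨by fun_prop, ?_⟩
  rw [fluxMeasure, Measure.map_map (by fun_prop) (measurable_fluxMap D)]
  have h : MeasurePreserving
      (Prod.map id fun m => m + k : (E → ℝ) × (F → ℤ) → (E → ℝ) × (F → ℤ))
      ((volume.restrict (angleCube E)).prod (Measure.pi fun _ : F => (Measure.count : Measure ℤ)))
      ((volume.restrict (angleCube E)).prod
        (Measure.pi fun _ : F => (Measure.count : Measure ℤ))) :=
    (MeasurePreserving.id _).prod (measurePreserving_add_right _ k)
  conv_rhs => rw [← h.map_eq, Measure.map_map (measurable_fluxMap D) h.measurable]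
  congr 1
  ext p f
  simp [fluxMap]
  ring

/-- Translating `ω` by `Dφ` amounts to translating `θ` by `φ`; the integral over `m` is
`2π`-periodic in `θ` since `D` maps integer vectors to integer vectors. -/
lemma measurePreserving_add_range (hD : ∀ n : E → ℤ, ∃ m : F → ℤ,
      D (fun e => (n e : ℝ)) = WithLp.toLp 2 fun f => (m f : ℝ)) (φ : E → ℝ) :
    MeasurePreserving (fun ω => ω + D φ) (fluxMeasure D) (fluxMeasure D) := by
  refine ⟨by fun_prop, ?_⟩
  refine Measure.ext_of_lintegral _ fun f hf => ?_
  have hcount : ∀ g : EuclideanSpace ℝ F → ℝ≥0∞, Measurable g →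
      ∫⁻ ω, g ω ∂(fluxMeasure D) = ∫⁻ θ in angleCube E,
        ∫⁻ m, g (fluxMap D (θ, m)) ∂(Measure.pi fun _ : F => (Measure.count : Measure ℤ)) := by
    intro g hg
    rw [fluxMeasure, lintegral_map hg (measurable_fluxMap D), lintegral_prod]
    exact (hg.comp (measurable_fluxMap D)).aemeasurable
  rw [lintegral_map hf (by fun_prop), hcount (fun ω => f (ω + D φ)) (hf.comp (by fun_prop)), hcount f hf]
  have hg : Measurable fun θ => ∫⁻ m, f (fluxMap D (θ, m))
      ∂(Measure.pi fun _ : F => (Measure.count : Measure ℤ)) :=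
    Measurable.lintegral_prod_right' (f := fun p => f (fluxMap D p))
      (hf.comp (measurable_fluxMap D))
  refine Eq.trans ?_ (setLIntegral_angleCube_add_right hg ?_ φ)
  · congr 1; ext θ; congr 1; ext m; congr 1
    ext e
    simp [fluxMap]
    ring
  · intro n θ
    obtain ⟨m, hm⟩ := hD n
    refine Eq.trans ?_ (lintegral_add_right_eq_self (fun k => f (fluxMap D (θ, k))) m)
    congr 1; ext k; congr 1
    have : (fun e => 2 * Real.pi * (n e : ℝ)) = (2 * Real.pi) • fun e => (n e : ℝ) := by
      ext; simp
    rw [fluxMap, fluxMap, this, map_add, map_smul, hm]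
    ext f
    simp
    ring

lemma integrable_gaussWeight_comp_fluxMap {b : ℝ} (hb : 0 < b) :
    Integrable (fun p => gaussWeight b (fluxMap D p))
      ((volume.restrict (angleCube E)).prod
        (Measure.pi fun _ : F => (Measure.count : Measure ℤ))) := by
  have hmeas : AEStronglyMeasurable (fun p => gaussWeight b (fluxMap D p))
      ((volume.restrict (angleCube E)).prod
        (Measure.pi fun _ : F => (Measure.count : Measure ℤ))) :=
    ((continuous_gaussWeight b).measurable.comp (measurable_fluxMap D)).aestronglyMeasurable
  refine (integrable_prod_iff hmeas).2 ⟨Eventually.of_forall fun θ => ?_, ?_⟩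
  · simp_rw [gaussWeight_fluxMap]
    exact Integrable.fintype_prod
      (f := fun f (m : ℤ) => Real.exp (-(b / 2) * (2 * Real.pi * (m : ℝ) + D θ f) ^ 2))
      fun f => integrable_villain_summand hb _
  · have hcube : Bornology.IsBounded (angleCube E) :=
      Bornology.IsBounded.pi fun _ => Metric.isBounded_Ico _ _
    obtain ⟨M, hM⟩ := ((LinearMap.toContinuousLinearMap D).lipschitz.isBounded_image
      hcube).exists_norm_le
    obtain ⟨c, hc, h⟩ := exists_villainWeight_summand_le hb M
    have hfin : volume (angleCube E) < ∞ := hcube.measure_lt_top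
    have : IsFiniteMeasure (volume.restrict (angleCube E)) := ⟨by simpa using hfin⟩
    refine (integrable_const ((∑' m, c m) ^ Fintype.card F)).mono'
      hmeas.norm.integral_prod_right' ?_
    refine (ae_restrict_iff' measurableSet_angleCube).2 (Eventually.of_forall fun θ hθ => ?_)
    have h0 : ∀ f, 0 ≤ villainWeight b (D θ f) := fun f => tsum_nonneg fun m => (Real.exp_pos _).le
    simp_rw [Real.norm_of_nonneg (gaussWeight_pos b _).le]
    rw [integral_gaussWeight_fluxMap D hb, Real.norm_of_nonneg (Finset.prod_nonneg fun f _ => h0 f)]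
    rw [← Finset.card_univ, ← Finset.prod_const]
    refine Finset.prod_le_prod (fun f _ => h0 f) fun f _ => ?_
    have ht : |D θ f| ≤ M := (PiLp.norm_apply_le (D θ) f).trans (hM _ ⟨θ, hθ, rfl⟩)
    exact Summable.tsum_le_tsum (h _ ht)
      (integrable_count_iff.1 (integrable_villain_summand hb _)).of_norm hc

lemma integrable_gaussWeight_fluxMeasure {b : ℝ} (hb : 0 < b) :
    Integrable (gaussWeight b) (fluxMeasure D) :=
  (integrable_map_measure (continuous_gaussWeight b).measurable.aestronglyMeasurable
    (measurable_fluxMap D).aemeasurable).2 (integrable_gaussWeight_comp_fluxMap D hb)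

lemma integral_gaussWeight_fluxMeasure {b : ℝ} (hb : 0 < b) :
    ∫ ω, gaussWeight b ω ∂(fluxMeasure D) =
      ∫ θ in angleCube E, ∏ f, villainWeight b (D θ f) := by
  rw [fluxMeasure, integral_map (measurable_fluxMap D).aemeasurable
    (continuous_gaussWeight b).measurable.aestronglyMeasurable,
    integral_prod _ (integrable_gaussWeight_comp_fluxMap D hb)]
  simp_rw [integral_gaussWeight_fluxMap D hb]

/-- The trace of the orthogonal projection onto `V`, computed in an orthonormal basis. -/
lemma sum_norm_sq_starProjection {H ι : Type*} [NormedAddCommGroup H] [InnerProductSpace ℝ H]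
    [FiniteDimensional ℝ H] [Fintype ι] (V : Submodule ℝ H) (e : OrthonormalBasis ι ℝ H) :
    ∑ i, ‖V.starProjection (e i)‖ ^ 2 = Module.finrank ℝ V := by
  have h : ∀ i, ‖V.starProjection (e i)‖ ^ 2 =
      ∑ k, ⟪e i, (stdOrthonormalBasis ℝ V k : H)⟫ ^ 2 := by
    intro i
    change ‖V.orthogonalProjectionOnto (e i)‖ ^ 2 = _
    rw [← (stdOrthonormalBasis ℝ V).sum_sq_inner_right]
    refine Finset.sum_congr rfl fun k _ => ?_
    rw [Submodule.inner_orthogonalProjectionOnto_eq_of_mem_left, real_inner_comm]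
  simp_rw [h]
  rw [Finset.sum_comm]
  simp_rw [e.sum_sq_inner_right, Submodule.norm_coe, OrthonormalBasis.norm_eq_one]
  simp

lemma norm_starProjection_orthogonal_le {H : Type*} [NormedAddCommGroup H] [InnerProductSpace ℝ H]
    [FiniteDimensional ℝ H] (V : Submodule ℝ H) (x : H) {v : H} (hv : v ∈ V) :
    ‖Vᗮ.starProjection x‖ ≤ ‖x - v‖ := by
  have h : Vᗮ.starProjection x = Vᗮ.starProjection (x - v) := by
    rw [map_sub, (Submodule.starProjection_orthogonal_apply_eq_zero hv), sub_zero]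
  rw [h]
  exact Submodule.norm_starProjection_apply_le _ _

lemma integral_gaussWeight_fluxMeasure_pos {b : ℝ} (hb : 0 < b) :
    0 < ∫ ω, gaussWeight b ω ∂(fluxMeasure D) := by
  have : NeZero (fluxMeasure D) := ⟨fluxMeasure_ne_zero D⟩
  exact integral_exp_pos (integrable_gaussWeight_fluxMeasure D hb)

/-- The spin-wave part of the logarithmic derivative is `-rank D / (2β)`; the rest is bounded using
any set `A` of coordinates `f` for which the `f`-th basis vector is at squared distance at most `η`
from the range of `D`. -/
theorem exists_hasDerivAt_log_integral_villainWeight [DecidableEq F]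
    (hD : ∀ n : E → ℤ, ∃ m : F → ℤ,
      D (fun e => (n e : ℝ)) = WithLp.toLp 2 fun f => (m f : ℝ))
    {β : ℝ} (hβ : 0 < β) (A : Finset F) {η r₁ r₂ : ℝ}
    (hA : ∀ f ∈ A, ∃ θ, ‖EuclideanSpace.single f 1 - D θ‖ ^ 2 ≤ η)
    (hr₁ : r₁ ≤ Module.finrank ℝ (LinearMap.range D))
    (hr₂ : Module.finrank ℝ (LinearMap.range D) ≤ r₂) :
    ∃ L : ℝ, HasDerivAt
        (fun b : ℝ => Real.log (∫ θ in angleCube E, ∏ f, villainWeight b (D θ f))) L β ∧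
      L ≤ -(r₁ / (2 * β) + Real.pi ^ 2 / 6 * Real.exp (-(2 * Real.pi ^ 2 * β * η)) *
        (3 / 4 * (A.card : ℝ) - r₂)) := by
  set V := LinearMap.range D with hVdef
  set Z := ∫ ω, gaussWeight β ω ∂(fluxMeasure D) with hZ
  have hZpos : 0 < Z := integral_gaussWeight_fluxMeasure_pos D hβ
  set e := EuclideanSpace.basisFun F ℝ with he
  set I := ∫ ω, ‖ω‖ ^ 2 * gaussWeight β ω ∂(fluxMeasure D) with hI
  have hder := hasDerivAt_integral_gaussWeight (ν := fluxMeasure D)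
    (fun b hb => integrable_gaussWeight_fluxMeasure D hb) hβ
  have hlog := hder.log hZpos.ne'
  have heq : (fun b : ℝ => Real.log (∫ θ in angleCube E, ∏ f, villainWeight b (D θ f))) =ᶠ[𝓝 β]
      fun b => Real.log (∫ ω, gaussWeight b ω ∂(fluxMeasure D)) := by
    filter_upwards [lt_mem_nhds hβ] with b hb
    rw [integral_gaussWeight_fluxMeasure D hb]
  refine ⟨_, hlog.congr_of_eventuallyEq heq, ?_⟩
  have hmain := le_integral_norm_sq_mul_gaussWeight (ν := fluxMeasure D)
    (fun b hb => integrable_gaussWeight_fluxMeasure D hb) hβ V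
    (by rintro _ ⟨φ, rfl⟩; exact measurePreserving_add_range D hD φ) e
    (by
      intro f
      have := measurePreserving_add_two_pi D (Pi.single f 1)
      convert! this using 4
      ext g
      simp [he, Pi.single_apply])
  rw [← hZ, ← hI] at hmain
  set a : F → ℝ := fun f => ‖Vᗮ.starProjection (e f)‖ ^ 2 with ha
  have haA : ∀ f ∈ A, a f ≤ η := by
    intro f hf
    obtain ⟨θ, hθ⟩ := hA f hf
    refine le_trans ?_ hθ
    have h1 := norm_starProjection_orthogonal_le V (e f) (v := D θ) ⟨θ, rfl⟩
    rw [he, EuclideanSpace.basisFun_apply] at h1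
    simp only [ha, he, EuclideanSpace.basisFun_apply]
    gcongr
  have hsumA : (A.card : ℝ) - r₂ ≤ ∑ f ∈ A, a f := by
    have h1 : ∀ f, a f = 1 - ‖V.starProjection (e f)‖ ^ 2 := by
      intro f
      have := Submodule.norm_sq_eq_add_norm_sq_starProjection (e f) V
      rw [OrthonormalBasis.norm_eq_one] at this
      simp only [ha]; linarith
    have h2 : ∑ f ∈ A, ‖V.starProjection (e f)‖ ^ 2 ≤ r₂ := by
      refine le_trans ?_ hr₂
      rw [← sum_norm_sq_starProjection V e]
      exact Finset.sum_le_univ_sum_of_nonneg fun f => by positivity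
    simp_rw [h1]
    rw [Finset.sum_sub_distrib]
    simp
    linarith
  set c := Real.exp (-(2 * Real.pi ^ 2 * β * η)) with hc
  have hc0 : 0 < c := Real.exp_pos _
  have hsum : Real.pi ^ 2 / 3 * c * (3 / 4 * (A.card : ℝ) - r₂) ≤
      ∑ f, Real.pi ^ 2 / 3 * a f ^ 2 * Real.exp (-(2 * Real.pi ^ 2 * β * a f)) := by
    calc Real.pi ^ 2 / 3 * c * (3 / 4 * (A.card : ℝ) - r₂)
        ≤ Real.pi ^ 2 / 3 * c * ∑ f ∈ A, (a f - 1 / 4) := by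
          gcongr
          rw [Finset.sum_sub_distrib]
          simp
          linarith
      _ ≤ Real.pi ^ 2 / 3 * c * ∑ f ∈ A, a f ^ 2 := by
          gcongr with f _
          nlinarith [sq_nonneg (a f - 1 / 2)]
      _ = ∑ f ∈ A, Real.pi ^ 2 / 3 * a f ^ 2 * c := by
          rw [Finset.mul_sum]
          exact Finset.sum_congr rfl fun _ _ => by ring
      _ ≤ ∑ f ∈ A, Real.pi ^ 2 / 3 * a f ^ 2 * Real.exp (-(2 * Real.pi ^ 2 * β * a f)) := by
          gcongr with f hf
          rw [hc]
          have := haA f hf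
          gcongr
      _ ≤ _ := Finset.sum_le_univ_sum_of_nonneg fun f => by positivity
  have h3 : (r₁ / β + Real.pi ^ 2 / 3 * c * (3 / 4 * (A.card : ℝ) - r₂)) * Z ≤ I := by
    refine le_trans ?_ hmain
    gcongr
  have h4 : r₁ / β + Real.pi ^ 2 / 3 * c * (3 / 4 * (A.card : ℝ) - r₂) ≤ I / Z :=
    (le_div_iff₀ hZpos).2 h3
  have h5 : -(1 / 2) * I / Z = -(1 / 2) * (I / Z) := by ring
  rw [h5]
  have h6 : r₁ / (2 * β) = r₁ / β / 2 := by ring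
  rw [h6]
  linarith

end FluxMeasure

/-! ### The exterior derivative on the box and its rank -/

lemma unitVec_apply (μ i : Fin 4) : unitVec μ i = if i = μ then 1 else 0 := by
  simp [unitVec, Pi.single_apply]

lemma mem_boxVertices {j : ℕ} {x : Fin 4 → ℤ} :
    x ∈ boxVertices j ↔ ∀ i, -(j : ℤ) ≤ x i ∧ x i ≤ j := by
  simp [boxVertices]

lemma mem_edges_zero {j : ℕ} {x : Fin 4 → ℤ} {μ : Fin 4} :
    (x, μ) ∈ edges .zero j ↔
      (∀ i, i ≠ μ → -(j : ℤ) < x i ∧ x i < j) ∧ -(j : ℤ) ≤ x μ ∧ x μ + 1 ≤ j := by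
  simp only [edges, boxEdges, EdgeOnBoundary, Finset.mem_filter, Finset.mem_product,
    mem_boxVertices, Finset.mem_univ, and_true, Pi.add_apply, unitVec_apply, not_exists, not_and]
  constructor
  · rintro ⟨⟨h1, h2⟩, h3⟩
    refine ⟨fun i hi => abs_lt.1 (lt_of_le_of_ne (abs_le.2 (h1 i)) (h3 i hi)), (h1 μ).1, ?_⟩
    simpa using (h2 μ).2
  · rintro ⟨h1, h2, h3⟩
    refine ⟨⟨fun i => ?_, fun i => ?_⟩, fun i hi => (abs_lt.2 (h1 i hi)).ne⟩
    · by_cases hi : i = μ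
      · subst hi; omega
      · have := h1 i hi; omega
    · by_cases hi : i = μ
      · subst hi; simp; omega
      · have := h1 i hi; simp [hi]; omega

lemma mem_plaquettes_zero {j : ℕ} {x : Fin 4 → ℤ} {μ ν : Fin 4} :
    (x, μ, ν) ∈ plaquettes .zero j ↔ μ < ν ∧
      (∀ i, i ≠ μ → i ≠ ν → -(j : ℤ) < x i ∧ x i < j) ∧ (-(j : ℤ) ≤ x μ ∧ x μ + 1 ≤ j) ∧
        -(j : ℤ) ≤ x ν ∧ x ν + 1 ≤ j := by
  simp only [plaquettes, boxPlaquettes, PlaquetteOnBoundary, Finset.mem_filter, Finset.mem_product,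
    mem_boxVertices, Finset.mem_univ, and_true, Pi.add_apply, unitVec_apply, not_exists, not_and]
  constructor
  · rintro ⟨⟨h1, h2, h3⟩, h4⟩
    have hne := h2.ne
    refine ⟨h2, fun i hi hi' => abs_lt.1 (lt_of_le_of_ne (abs_le.2 (h1 i)) (h4 i hi hi')),
      ⟨(h1 μ).1, ?_⟩, (h1 ν).1, ?_⟩
    · simpa [hne] using (h3 μ).2
    · simpa [hne.symm] using (h3 ν).2
  · rintro ⟨h1, h2, h3, h4⟩
    have hne := h1.ne
    refine ⟨⟨fun i => ?_, h1, fun i => ?_⟩, fun i hi hi' => (abs_lt.2 (h2 i hi hi')).ne⟩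
    · by_cases hi : i = μ
      · subst hi; omega
      · by_cases hi' : i = ν
        · subst hi'; omega
        · have := h2 i hi hi'; omega
    · by_cases hi : i = μ
      · subst hi; simp [hne]; omega
      · by_cases hi' : i = ν
        · subst hi'; simp [hi]; omega
        · have := h2 i hi hi'; simp [hi, hi']; omega

lemma edges_zero_subset (bc : BoundaryCondition) (j : ℕ) : edges .zero j ⊆ edges bc j := by
  cases bc
  · exact Finset.filter_subset _ _
  · exact subset_rfl

lemma plaquettes_zero_subset (bc : BoundaryCondition) (j : ℕ) :
    plaquettes .zero j ⊆ plaquettes bc j := by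
  cases bc
  · exact Finset.filter_subset _ _
  · exact subset_rfl

lemma edges_subset_boxEdges (bc : BoundaryCondition) (j : ℕ) : edges bc j ⊆ boxEdges j := by
  cases bc
  · exact subset_rfl
  · exact Finset.filter_subset _ _

lemma plaquettes_subset_boxPlaquettes (bc : BoundaryCondition) (j : ℕ) :
    plaquettes bc j ⊆ boxPlaquettes j := by
  cases bc
  · exact subset_rfl
  · exact Finset.filter_subset _ _

lemma lt_of_mem_plaquettes {bc : BoundaryCondition} {j : ℕ} {f : Plaquette}
    (hf : f ∈ plaquettes bc j) : f.2.1 < f.2.2 :=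
  (Finset.mem_filter.1 (plaquettes_subset_boxPlaquettes bc j hf)).2.1

lemma card_piFinset_Icc (k : ℕ) :
    (Fintype.piFinset fun _ : Fin 4 => Finset.Icc (-(k : ℤ)) (k : ℤ)).card = (2 * k + 1) ^ 4 := by
  rw [Fintype.card_piFinset]
  simp only [Int.card_Icc, Finset.prod_const, Finset.card_univ, Fintype.card_fin]
  congr 1; omega

lemma card_edges_le (bc : BoundaryCondition) (j : ℕ) : (edges bc j).card ≤ 4 * (2 * j + 1) ^ 4 := by
  refine (Finset.card_le_card
    ((edges_subset_boxEdges bc j).trans (Finset.filter_subset _ _))).trans ?_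
  rw [Finset.card_product, boxVertices, card_piFinset_Icc]
  simp [mul_comm]

lemma card_plaquettes_le (bc : BoundaryCondition) (j : ℕ) :
    (plaquettes bc j).card ≤ 6 * (2 * j + 1) ^ 4 := by
  have h : plaquettes bc j ⊆ boxVertices j ×ˢ
      (Finset.univ : Finset (Fin 4 × Fin 4)).filter fun p => p.1 < p.2 := by
    refine (plaquettes_subset_boxPlaquettes bc j).trans fun f hf => ?_
    simp only [boxPlaquettes, Finset.mem_filter, Finset.mem_product, Finset.mem_univ,
      and_true, true_and] at hf ⊢
    exact ⟨hf.1, hf.2.1⟩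
  refine (Finset.card_le_card h).trans ?_
  rw [Finset.card_product, boxVertices, card_piFinset_Icc, mul_comm]
  exact Nat.mul_le_mul_right _ (by decide)

lemma mem_edges_zero_of_abs_lt {j : ℕ} {e : Edge} (h : ∀ i, |e.1 i| < (j : ℤ)) :
    e ∈ edges .zero j := by
  refine mem_edges_zero.2 ⟨fun i _ => abs_lt.1 (h i), ?_⟩
  have := abs_lt.1 (h e.2)
  omega

lemma mem_plaquettes_zero_of_abs_lt {j : ℕ} {f : Plaquette} (hf : f.2.1 < f.2.2)
    (h : ∀ i, |f.1 i| < (j : ℤ)) : f ∈ plaquettes .zero j := by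
  obtain ⟨x, μ, ν⟩ := f
  refine mem_plaquettes_zero.2 ⟨hf, fun i _ _ => abs_lt.1 (h i), ?_⟩
  have h1 := abs_lt.1 (h μ)
  have h2 := abs_lt.1 (h ν)
  dsimp only at *
  omega

/-- A `1`-form which vanishes outside the edges with zero boundary conditions has its exterior
derivative supported on the plaquettes with zero boundary conditions. -/
lemma extDeriv_eq_zero_of_notMem {j : ℕ} {φ : Edge → ℝ} (hφ : ∀ e, e ∉ edges .zero j → φ e = 0)
    {g : Plaquette} (hg : g.2.1 < g.2.2) (hgn : g ∉ plaquettes .zero j) : extDeriv φ g = 0 := by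
  obtain ⟨x, μ, ν⟩ := g
  simp only at hg
  have hne := hg.ne
  have key : ∀ e : Edge, (e ∈ edges .zero j → (x, μ, ν) ∈ plaquettes .zero j) → φ e = 0 :=
    fun e he => hφ e fun h => hgn (he h)
  rw [extDeriv, key, key, key, key]
  · ring
  · intro h
    obtain ⟨h1, h2⟩ := mem_edges_zero.1 h
    have := h1 μ hne
    exact mem_plaquettes_zero.2 ⟨hg, fun i hi hi' => h1 i hi', by dsimp only at *; omega, h2⟩
  · intro h
    obtain ⟨h1, h2⟩ := mem_edges_zero.1 h
    simp only [Pi.add_apply, unitVec_apply, hne, if_false, add_zero] at h1 h2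
    have := h1 ν hne.symm
    simp only [if_true] at this
    exact mem_plaquettes_zero.2
      ⟨hg, fun i hi hi' => by simpa [hi'] using h1 i hi, h2, by dsimp only at *; omega⟩
  · intro h
    obtain ⟨h1, h2⟩ := mem_edges_zero.1 h
    simp only [Pi.add_apply, unitVec_apply, hne.symm, if_false, add_zero] at h1 h2
    have := h1 μ hne
    simp only [if_true] at this
    exact mem_plaquettes_zero.2
      ⟨hg, fun i hi hi' => by simpa [hi] using h1 i hi', by dsimp only at *; omega, h2⟩
  · intro h
    obtain ⟨h1, h2⟩ := mem_edges_zero.1 h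
    have := h1 ν hne.symm
    exact mem_plaquettes_zero.2 ⟨hg, fun i hi hi' => h1 i hi, h2, by dsimp only at *; omega⟩

lemma extDeriv_swap (a : Edge → ℝ) (x : Fin 4 → ℤ) (μ ν : Fin 4) :
    extDeriv a (x, ν, μ) = -extDeriv a (x, μ, ν) := by
  simp only [extDeriv]; ring

/-- The exterior derivative on `1`-forms of the box, as a linear map into the Euclidean space of
`2`-forms. -/
noncomputable def extMap (bc : BoundaryCondition) (j : ℕ) :
    (edges bc j → ℝ) →ₗ[ℝ] EuclideanSpace ℝ (plaquettes bc j) where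
  toFun θ := WithLp.toLp 2 fun f => extDeriv (oneForm bc j θ) f
  map_add' a b := by
    have h : ∀ e, oneForm bc j (a + b) e = oneForm bc j a e + oneForm bc j b e := by
      intro e; simp only [oneForm]; split_ifs <;> simp
    ext f
    simp only [extDeriv, h, PiLp.add_apply]
    ring
  map_smul' c a := by
    have h : ∀ e, oneForm bc j (c • a) e = c * oneForm bc j a e := by
      intro e; simp only [oneForm]; split_ifs <;> simp
    ext f
    simp only [extDeriv, h, PiLp.smul_apply, smul_eq_mul, RingHom.id_apply]
    ring

lemma extMap_apply (bc : BoundaryCondition) (j : ℕ) (θ : edges bc j → ℝ) (f : plaquettes bc j) :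
    extMap bc j θ f = extDeriv (oneForm bc j θ) f := rfl

lemma exists_extMap_intCast (bc : BoundaryCondition) (j : ℕ) (n : edges bc j → ℤ) :
    ∃ m : plaquettes bc j → ℤ,
      extMap bc j (fun e => (n e : ℝ)) = WithLp.toLp 2 fun f => (m f : ℝ) := by
  have h : ∀ e, ∃ k : ℤ, oneForm bc j (fun e => (n e : ℝ)) e = k := by
    intro e
    by_cases he : e ∈ edges bc j
    · exact ⟨n ⟨e, he⟩, by simp [oneForm, he]⟩
    · exact ⟨0, by simp [oneForm, he]⟩
  choose k hk using h
  refine ⟨fun f => k (f.1.1, f.1.2.1) + k (f.1.1 + unitVec f.1.2.1, f.1.2.2)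
    - k (f.1.1 + unitVec f.1.2.2, f.1.2.1) - k (f.1.1, f.1.2.2), ?_⟩
  ext f
  rw [extMap_apply, extDeriv]
  simp [hk]

lemma partitionFunction_eq (bc : BoundaryCondition) (j : ℕ) (b : ℝ) :
    partitionFunction bc j b =
      ∫ θ in angleCube (edges bc j), ∏ f, villainWeight b (extMap bc j θ f) := by
  rw [partitionFunction, angleCube]
  congr 1; ext θ
  exact (Finset.prod_coe_sort (plaquettes bc j)
    fun f => villainWeight b (extDeriv (oneForm bc j θ) f)).symm

lemma oneForm_restrict {bc : BoundaryCondition} {j : ℕ} {φ : Edge → ℝ}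
    (hφ : ∀ e, e ∉ edges .zero j → φ e = 0) : oneForm bc j (fun e => φ e) = φ := by
  ext e
  by_cases he : e ∈ edges bc j
  · simp [oneForm, he]
  · simp [oneForm, he, hφ e fun h => he (edges_zero_subset bc j h)]

lemma eq_zero_of_add_unitVec {h : (Fin 4 → ℤ) → ℝ} {i : Fin 4} {N : ℤ}
    (hper : ∀ x, h (x + unitVec i) = h x) (hN : ∀ x, N ≤ x i → h x = 0) (x : Fin 4 → ℤ) :
    h x = 0 := by
  have h1 : ∀ n : ℕ, h (x + n • unitVec i) = h x := by
    intro n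
    induction n with
    | zero => simp
    | succ n ih => rw [succ_nsmul, ← add_assoc, hper, ih]
  rw [← h1 (N - x i).toNat]
  apply hN
  simp [unitVec_apply]
  omega

/-- The vertices in the interior of the box. -/
noncomputable def interiorVertices (j : ℕ) : Finset (Fin 4 → ℤ) :=
  Fintype.piFinset fun _ => Finset.Icc (-(j : ℤ) + 1) ((j : ℤ) - 1)

lemma mem_interiorVertices {j : ℕ} {x : Fin 4 → ℤ} :
    x ∈ interiorVertices j ↔ ∀ i, |x i| < (j : ℤ) := by
  simp only [interiorVertices, Fintype.mem_piFinset, Finset.mem_Icc, abs_lt]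
  refine forall_congr' fun i => ?_
  omega

lemma card_interiorVertices (j : ℕ) : (interiorVertices j).card = (2 * j - 1) ^ 4 := by
  rw [interiorVertices, Fintype.card_piFinset]
  simp only [Int.card_Icc, Finset.prod_const, Finset.card_univ, Fintype.card_fin]
  congr 1; omega

/-- The extension by zero of `1`-forms without component in the last direction. -/
noncomputable def axialForm (j : ℕ) :
    (interiorVertices j × Fin 3 → ℝ) →ₗ[ℝ] (Edge → ℝ) where
  toFun a e := if h : e.1 ∈ interiorVertices j ∧ (e.2 : ℕ) < 3 then
    a (⟨e.1, h.1⟩, ⟨e.2, h.2⟩) else 0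
  map_add' a b := by ext e; simp only [Pi.add_apply]; split_ifs <;> simp
  map_smul' c a := by
    ext e; simp only [Pi.smul_apply, RingHom.id_apply, smul_eq_mul]; split_ifs <;> simp

/-- A `1`-form in axial gauge which is closed is constant along the last direction, hence zero if
it vanishes on the boundary: `d` is injective on these forms. -/
lemma le_finrank_range_extMap (bc : BoundaryCondition) (j : ℕ) :
    3 * (2 * j - 1) ^ 4 ≤ Module.finrank ℝ (LinearMap.range (extMap bc j)) := by
  have hsupp : ∀ (a : interiorVertices j × Fin 3 → ℝ) e, e ∉ edges .zero j →
      axialForm j a e = 0 := by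
    intro a e he
    refine dif_neg fun h => he ?_
    exact mem_edges_zero_of_abs_lt (mem_interiorVertices.1 h.1)
  let r : (Edge → ℝ) →ₗ[ℝ] (edges bc j → ℝ) := LinearMap.funLeft ℝ ℝ Subtype.val
  have hinj : Function.Injective ((extMap bc j).comp (r.comp (axialForm j))) := by
    rw [← LinearMap.ker_eq_bot, LinearMap.ker_eq_bot']
    intro a ha
    have hone : oneForm bc j (r (axialForm j a)) = axialForm j a := oneForm_restrict (hsupp a)
    have hd : ∀ g : Plaquette, g.2.1 < g.2.2 → extDeriv (axialForm j a) g = 0 := by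
      intro g hg
      by_cases hgm : g ∈ plaquettes .zero j
      · have := congrArg (fun v => v ⟨g, plaquettes_zero_subset bc j hgm⟩) ha
        simp only [LinearMap.comp_apply, extMap_apply, hone] at this
        simpa using this
      · exact extDeriv_eq_zero_of_notMem (hsupp a) hg hgm
    have h3 : ∀ x, axialForm j a (x, 3) = 0 := fun x => dif_neg fun h => absurd h.2 (lt_irrefl 3)
    have hzero : ∀ (μ : Fin 3) x, axialForm j a (x, μ.castSucc) = 0 := by
      intro μ x
      refine eq_zero_of_add_unitVec (h := fun x => axialForm j a (x, μ.castSucc)) (i := 3) (N := j)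
        (fun y => ?_) (fun y hy => ?_) x
      · have := hd (y, μ.castSucc, 3) (Fin.castSucc_lt_last μ)
        simp only [extDeriv, h3] at this
        linarith
      · refine dif_neg fun h => ?_
        have := abs_lt.1 (mem_interiorVertices.1 h.1 3)
        simp only at this
        omega
    ext ⟨⟨x, hx⟩, μ⟩
    have := hzero μ x
    simpa [axialForm, hx] using this
  have h1 := LinearMap.finrank_range_of_inj hinj
  have h2 : Module.finrank ℝ (interiorVertices j × Fin 3 → ℝ) = 3 * (2 * j - 1) ^ 4 := by
    rw [Module.finrank_fintype_fun_eq_card, Fintype.card_prod, Fintype.card_coe,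
      card_interiorVertices, Fintype.card_fin, mul_comm]
  rw [← h2, ← h1]
  exact Submodule.finrank_mono (LinearMap.range_comp_le_range _ _)

/-- The discrete gradient of the extension by zero of a function on the interior of the box. -/
noncomputable def gradForm (j : ℕ) : (interiorVertices j → ℝ) →ₗ[ℝ] (Edge → ℝ) where
  toFun ψ e := (if h : e.1 + unitVec e.2 ∈ interiorVertices j then ψ ⟨_, h⟩ else 0) -
    (if h : e.1 ∈ interiorVertices j then ψ ⟨_, h⟩ else 0)
  map_add' a b := by ext e; simp only [Pi.add_apply]; split_ifs <;> ring
  map_smul' c a := by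
    ext e; simp only [Pi.smul_apply, RingHom.id_apply, smul_eq_mul]; split_ifs <;> ring

/-- Gradients of functions vanishing on the boundary are in the kernel of `d`. -/
lemma finrank_range_extMap_add_le (bc : BoundaryCondition) (j : ℕ) :
    Module.finrank ℝ (LinearMap.range (extMap bc j)) + (2 * j - 1) ^ 4 ≤ 4 * (2 * j + 1) ^ 4 := by
  let r : (Edge → ℝ) →ₗ[ℝ] (edges bc j → ℝ) := LinearMap.funLeft ℝ ℝ Subtype.val
  let G : (interiorVertices j → ℝ) →ₗ[ℝ] (edges bc j → ℝ) := r.comp (gradForm j)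
  let ext0 : (interiorVertices j → ℝ) → (Fin 4 → ℤ) → ℝ := fun ψ x =>
    if h : x ∈ interiorVertices j then ψ ⟨_, h⟩ else 0
  have hgrad : ∀ ψ x μ, gradForm j ψ (x, μ) = ext0 ψ (x + unitVec μ) - ext0 ψ x := fun _ _ _ => rfl
  have hsupp : ∀ ψ e, e ∉ edges .zero j → gradForm j ψ e = 0 := by
    rintro ψ ⟨x, μ⟩ he
    have h1 : x ∉ interiorVertices j := fun h =>
      he (mem_edges_zero_of_abs_lt (mem_interiorVertices.1 h))
    have h2 : x + unitVec μ ∉ interiorVertices j := by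
      intro h
      rw [mem_interiorVertices] at h
      refine he (mem_edges_zero.2 ⟨fun i hi => ?_, ?_⟩)
      · have := abs_lt.1 (h i)
        simpa [unitVec_apply, hi] using this
      · have := abs_lt.1 (h μ)
        simp [unitVec_apply] at this
        omega
    rw [hgrad]
    simp only [ext0, dif_neg h1, dif_neg h2, sub_zero]
  have hone : ∀ ψ, oneForm bc j (G ψ) = gradForm j ψ := fun ψ => oneForm_restrict (hsupp ψ)
  have hker : LinearMap.range G ≤ LinearMap.ker (extMap bc j) := by
    rintro _ ⟨ψ, rfl⟩
    rw [LinearMap.mem_ker]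
    ext f
    rw [extMap_apply, hone, extDeriv]
    simp only [hgrad, add_right_comm f.1.1 (unitVec f.1.2.2)]
    simp
  have hinj : Function.Injective G := by
    rw [← LinearMap.ker_eq_bot, LinearMap.ker_eq_bot']
    intro ψ hψ
    have h0 : ∀ e, gradForm j ψ e = 0 := by
      intro e
      rw [← hone, hψ]
      simp [oneForm]
    have hz : ∀ x, ext0 ψ x = 0 := by
      refine eq_zero_of_add_unitVec (i := 0) (N := j) (fun x => ?_) fun x hx => ?_
      · have := h0 (x, 0)
        rw [hgrad] at this
        linarith
      · refine dif_neg fun h => ?_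
        have := abs_lt.1 (mem_interiorVertices.1 h 0)
        omega
    ext ⟨x, hx⟩
    simpa [ext0, hx] using hz x
  have h1 := LinearMap.finrank_range_of_inj hinj
  rw [Module.finrank_fintype_fun_eq_card, Fintype.card_coe, card_interiorVertices] at h1
  have h2 := Submodule.finrank_mono hker
  have h3 := LinearMap.finrank_range_add_finrank_ker (extMap bc j)
  rw [Module.finrank_fintype_fun_eq_card, Fintype.card_coe] at h3
  have h4 := card_edges_le bc j
  omega

/-! ### Approximating the indicator of a plaquette by exact forms -/

/-- The squared `ℓ²`-distance `1 - 2 dφ(f) + ‖dφ‖²` between the indicator `2`-form of the plaquette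
`f` and `dφ`. The sum runs over both orderings of the two directions of a plaquette, hence the
factor `1/2`. -/
noncomputable def defect (φ : Edge → ℝ) (f : Plaquette) : ℝ :=
  1 - 2 * extDeriv φ f + 1 / 2 * ∑' g : Plaquette, extDeriv φ g ^ 2

lemma tsum_extDeriv_sq {bc : BoundaryCondition} {j : ℕ} {φ : Edge → ℝ}
    (hφ : ∀ e, e ∉ edges .zero j → φ e = 0) :
    ∑' g : Plaquette, extDeriv φ g ^ 2 = 2 * ∑ g ∈ plaquettes bc j, extDeriv φ g ^ 2 := by
  let sw : Plaquette ↪ Plaquette :=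
    ((Equiv.refl (Fin 4 → ℤ)).prodCongr (Equiv.prodComm (Fin 4) (Fin 4))).toEmbedding
  have hsw : ∀ g, extDeriv φ (sw g) ^ 2 = extDeriv φ g ^ 2 := by
    rintro ⟨x, μ, ν⟩
    change extDeriv φ (x, ν, μ) ^ 2 = _
    rw [extDeriv_swap, neg_sq]
  have hdisj : Disjoint (plaquettes bc j) ((plaquettes bc j).map sw) := by
    rw [Finset.disjoint_left]
    intro g hg hg'
    obtain ⟨g₀, hg₀, rfl⟩ := Finset.mem_map.1 hg'
    exact lt_asymm (lt_of_mem_plaquettes hg) (lt_of_mem_plaquettes hg₀)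
  rw [tsum_eq_sum (s := (plaquettes bc j).disjUnion _ hdisj), Finset.sum_disjUnion, Finset.sum_map]
  · simp_rw [hsw]; ring
  · rintro ⟨x, μ, ν⟩ hg
    rw [Finset.mem_disjUnion, not_or] at hg
    rcases lt_trichotomy μ ν with h | h | h
    · rw [extDeriv_eq_zero_of_notMem hφ h fun hm => hg.1 (plaquettes_zero_subset bc j hm)]
      simp
    · subst h
      simp only [extDeriv]; ring
    · have hn : (x, ν, μ) ∉ plaquettes .zero j := fun hm =>
        hg.2 (Finset.mem_map.2 ⟨(x, ν, μ), plaquettes_zero_subset bc j hm, rfl⟩)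
      rw [extDeriv_swap, extDeriv_eq_zero_of_notMem hφ h hn]
      simp

lemma norm_single_sub_extMap_sq {bc : BoundaryCondition} {j : ℕ} {φ : Edge → ℝ}
    (hφ : ∀ e, e ∉ edges .zero j → φ e = 0) (f : plaquettes bc j) :
    ‖EuclideanSpace.single f 1 - extMap bc j (fun e => φ e)‖ ^ 2 = defect φ f := by
  have h1 : ∀ g, extMap bc j (fun e => φ e) g = extDeriv φ g := by
    intro g; rw [extMap_apply, oneForm_restrict hφ]
  rw [norm_sub_sq_real, PiLp.norm_single, EuclideanSpace.inner_single_left, h1, defect,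
    tsum_extDeriv_sq (bc := bc) hφ, EuclideanSpace.norm_sq_eq]
  simp only [h1, Real.norm_eq_abs, sq_abs]
  rw [Finset.sum_coe_sort (plaquettes bc j) fun g => extDeriv φ g ^ 2]
  simp

/-- The isometry of `ℤ⁴` permuting the coordinates by `σ` and then translating by `z`. -/
noncomputable def latticeIsometry (σ : Equiv.Perm (Fin 4)) (z : Fin 4 → ℤ) :
    (Fin 4 → ℤ) ≃ (Fin 4 → ℤ) :=
  (σ.arrowCongr (Equiv.refl ℤ)).trans (Equiv.addRight z)

lemma latticeIsometry_apply (σ : Equiv.Perm (Fin 4)) (z x : Fin 4 → ℤ) (i : Fin 4) :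
    latticeIsometry σ z x i = x (σ.symm i) + z i := rfl

lemma latticeIsometry_add_unitVec (σ : Equiv.Perm (Fin 4)) (z x : Fin 4 → ℤ) (μ : Fin 4) :
    latticeIsometry σ z (x + unitVec μ) = latticeIsometry σ z x + unitVec (σ μ) := by
  ext i
  simp only [latticeIsometry_apply, Pi.add_apply, unitVec_apply, Equiv.symm_apply_eq]
  ring

/-- The pullback of a `1`-form under a lattice isometry. -/
noncomputable def pullback (σ : Equiv.Perm (Fin 4)) (z : Fin 4 → ℤ) (φ : Edge → ℝ) : Edge → ℝ :=
  fun e => φ (latticeIsometry σ z e.1, σ e.2)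

lemma extDeriv_pullback (σ : Equiv.Perm (Fin 4)) (z : Fin 4 → ℤ) (φ : Edge → ℝ) (g : Plaquette) :
    extDeriv (pullback σ z φ) g = extDeriv φ (latticeIsometry σ z g.1, σ g.2.1, σ g.2.2) := by
  simp only [extDeriv, pullback, latticeIsometry_add_unitVec]

lemma defect_pullback (σ : Equiv.Perm (Fin 4)) (z : Fin 4 → ℤ) (φ : Edge → ℝ) (f : Plaquette) :
    defect (pullback σ z φ) f = defect φ (latticeIsometry σ z f.1, σ f.2.1, σ f.2.2) := by
  simp only [defect, extDeriv_pullback]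
  rw [← ((latticeIsometry σ z).prodCongr (σ.prodCongr σ)).tsum_eq fun g => extDeriv φ g ^ 2]
  rfl

lemma exists_perm_apply_eq {α : Type*} [DecidableEq α] {a b c d : α} (hab : a ≠ b) (hcd : c ≠ d) :
    ∃ σ : Equiv.Perm α, σ a = c ∧ σ b = d := by
  refine ⟨(Equiv.swap a c).trans (Equiv.swap (Equiv.swap a c b) d), ?_, ?_⟩
  · rw [Equiv.trans_apply, Equiv.swap_apply_left]
    refine Equiv.swap_apply_of_ne_of_ne (fun h => hab ?_) hcd
    apply (Equiv.swap a c).injective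
    rw [Equiv.swap_apply_left, ← h]
  · rw [Equiv.trans_apply, Equiv.swap_apply_left]

/-- The quantity `‖P δ_f‖²`, for `P` the projection onto the range of `d`, averages over the
plaquettes `f` to `rank d / #F`, which tends to `1/2`. Hence some plaquette has a `1`-form `φ` with
`‖δ_f - dφ‖²` almost `1/2`. -/
lemma exists_defect_le {ε : ℝ} (hε : 0 < ε) :
    ∃ (J : ℕ) (φ : Edge → ℝ) (f : Plaquette), (∀ e, e ∉ edges .zero J → φ e = 0) ∧
      f ∈ plaquettes .zero J ∧ defect φ f ≤ 1 / 2 + ε := by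
  have hlim : Tendsto (fun J : ℕ => (3 * (2 * (J : ℝ) - 1) ^ 4) / (6 * (2 * (J : ℝ) + 1) ^ 4)) atTop
      (𝓝 (1 / 2)) := by
    have h1 : Tendsto (fun J : ℕ => (1 / 2 : ℝ) * (1 - 2 / (2 * (J : ℝ) + 1)) ^ 4) atTop
        (𝓝 (1 / 2 * (1 - 0) ^ 4)) := by
      refine Tendsto.const_mul _ (Tendsto.pow (Tendsto.const_sub _ ?_) 4)
      refine Tendsto.const_div_atTop ?_ _
      exact tendsto_atTop_add_const_right _ _
        ((tendsto_natCast_atTop_atTop).const_mul_atTop two_pos)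
    rw [show (1 / 2 * (1 - 0) ^ 4 : ℝ) = 1 / 2 by norm_num] at h1
    refine h1.congr fun J => ?_
    have : (0 : ℝ) < 2 * J + 1 := by positivity
    field_simp
    ring
  obtain ⟨J, hJ, hJ1⟩ := ((hlim.eventually (lt_mem_nhds (show 1 / 2 - ε < 1 / 2 by linarith))).and
    (eventually_ge_atTop 1)).exists
  set D := extMap .zero J
  set V := LinearMap.range D
  set e := EuclideanSpace.basisFun (plaquettes .zero J) ℝ with he
  have hsum := sum_norm_sq_starProjection V e
  have hex : ∃ f, 1 / 2 - ε ≤ ‖V.starProjection (e f)‖ ^ 2 := by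
    by_contra! hcon
    have hpos : (0 : ℝ) < 6 * (2 * (J : ℝ) + 1) ^ 4 := by positivity
    have h1 : ((3 * (2 * J - 1) ^ 4 : ℕ) : ℝ) ≤ ∑ f, ‖V.starProjection (e f)‖ ^ 2 := by
      rw [hsum]
      exact_mod_cast le_finrank_range_extMap .zero J
    have h2 : ∑ f, ‖V.starProjection (e f)‖ ^ 2 ≤
        ((plaquettes .zero J).card : ℝ) * (1 / 2 - ε) := by
      refine (Finset.sum_le_sum fun f _ => (hcon f).le).trans_eq ?_
      rw [Finset.sum_const, Finset.card_univ, Fintype.card_coe, nsmul_eq_mul]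
    have h3 : ((plaquettes .zero J).card : ℝ) ≤ 6 * (2 * (J : ℝ) + 1) ^ 4 := by
      exact_mod_cast card_plaquettes_le .zero J
    have h4 : ((3 * (2 * J - 1) ^ 4 : ℕ) : ℝ) = 3 * (2 * (J : ℝ) - 1) ^ 4 := by
      push_cast [Nat.cast_sub (show 1 ≤ 2 * J by omega)]
      ring
    rw [lt_div_iff₀ hpos] at hJ
    have hJpos : (0 : ℝ) < 3 * (2 * (J : ℝ) - 1) ^ 4 := by
      have : (1 : ℝ) ≤ J := by exact_mod_cast hJ1
      have : (0 : ℝ) < 2 * (J : ℝ) - 1 := by linarith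
      positivity
    have hc0 : 0 ≤ ((plaquettes .zero J).card : ℝ) := by positivity
    have hpos' : 0 < 1 / 2 - ε := by
      by_contra hneg
      have := mul_nonpos_of_nonneg_of_nonpos hc0 (not_lt.1 hneg)
      linarith
    have := mul_le_mul_of_nonneg_right h3 hpos'.le
    linarith
  obtain ⟨f, hf⟩ := hex
  obtain ⟨θ, hθ⟩ : V.starProjection (e f) ∈ V := V.starProjection_apply_mem _
  have hvan : ∀ e, e ∉ edges .zero J → oneForm .zero J θ e = 0 := fun e he => dif_neg he
  refine ⟨J, oneForm .zero J θ, f, hvan, f.2, ?_⟩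
  rw [← norm_single_sub_extMap_sq hvan f]
  have hθ' : (fun e : edges .zero J => oneForm .zero J θ e) = θ := by
    ext e; simp [oneForm]
  rw [hθ']
  change ‖EuclideanSpace.single f 1 - D θ‖ ^ 2 ≤ _
  rw [hθ, ← EuclideanSpace.basisFun_apply, ← he, ← Submodule.starProjection_orthogonal_val]
  have := Submodule.norm_sq_eq_add_norm_sq_starProjection (e f) V
  rw [OrthonormalBasis.norm_eq_one] at this
  linarith

/-- By the symmetries of `ℤ⁴`, the `1`-form found at one plaquette can be carried to any other
plaquette far from the boundary, of any orientation and for either boundary condition. -/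
lemma exists_norm_single_sub_extMap_sq_le {ε : ℝ} (hε : 0 < ε) :
    ∃ R : ℕ, 0 < R ∧ ∀ (bc : BoundaryCondition) (j : ℕ) (f : plaquettes bc j),
      (∀ i, |f.1.1 i| + R ≤ j) →
        ∃ θ, ‖EuclideanSpace.single f 1 - extMap bc j θ‖ ^ 2 ≤ 1 / 2 + ε := by
  obtain ⟨J, φ, ⟨x₀, μ₀, ν₀⟩, hφ, hf₀, hdef⟩ := exists_defect_le hε
  refine ⟨2 * J + 1, by omega, fun bc j f hf => ?_⟩
  obtain ⟨⟨x, μ, ν⟩, hfm⟩ := f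
  obtain ⟨σ, hσμ, hσν⟩ := exists_perm_apply_eq (lt_of_mem_plaquettes hfm).ne
    (lt_of_mem_plaquettes hf₀).ne
  simp only at hσμ hσν hf
  set z : Fin 4 → ℤ := fun i => x₀ i - x (σ.symm i) with hz
  have hx : latticeIsometry σ z x = x₀ := by
    ext i; rw [latticeIsometry_apply, hz]; ring
  have hx₀ : ∀ i, |x₀ i| ≤ J := by
    have := plaquettes_subset_boxPlaquettes _ _ hf₀
    simp only [boxPlaquettes, Finset.mem_filter, Finset.mem_product, mem_boxVertices] at this
    exact fun i => abs_le.2 (this.1.1 i)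
  have hvan : ∀ e, e ∉ edges .zero j → pullback σ z φ e = 0 := by
    rintro ⟨y, κ⟩ he
    refine hφ _ fun hmem => he (mem_edges_zero_of_abs_lt fun i => ?_)
    have h1 : (latticeIsometry σ z y) ∈ boxVertices J :=
      (Finset.mem_product.1 (Finset.mem_filter.1 (edges_subset_boxEdges _ _ hmem)).1).1
    have h2 := mem_boxVertices.1 h1 (σ i)
    rw [latticeIsometry_apply, hz] at h2
    simp only [Equiv.symm_apply_apply] at h2
    have h3 := abs_le.1 (hx₀ (σ i))
    have h4 := hf i
    have h5 := neg_abs_le (x i)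
    have h6 := le_abs_self (x i)
    push_cast at h4
    rw [abs_lt]
    dsimp only
    constructor <;> omega
  refine ⟨fun e => pullback σ z φ e, ?_⟩
  rw [norm_single_sub_extMap_sq hvan, defect_pullback]
  simpa [hx, hσμ, hσν] using hdef

/-! ### The bound in a finite box and its limit -/

/-- The plaquettes at distance at least `R` from the boundary of the box. -/
noncomputable def deepPlaquettes (bc : BoundaryCondition) (j R : ℕ) : Finset (plaquettes bc j) :=
  Finset.univ.filter fun f => ∀ i, |f.1.1 i| + R ≤ j

lemma le_card_deepPlaquettes (bc : BoundaryCondition) {j R : ℕ} (hR : 0 < R) (hRj : R ≤ j) :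
    6 * (2 * (j - R) + 1) ^ 4 ≤ (deepPlaquettes bc j R).card := by
  have h : ((Fintype.piFinset fun _ : Fin 4 =>
      Finset.Icc (-((j - R : ℕ) : ℤ)) ((j - R : ℕ) : ℤ)) ×ˢ
      (Finset.univ : Finset (Fin 4 × Fin 4)).filter fun p => p.1 < p.2) ⊆
      (deepPlaquettes bc j R).map (Function.Embedding.subtype _) := by
    rintro ⟨x, μ, ν⟩ hx
    simp only [Finset.mem_product, Fintype.mem_piFinset, Finset.mem_Icc, Finset.mem_filter,
      Finset.mem_univ, true_and] at hx
    have habs : ∀ i, |x i| + R ≤ j := fun i => by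
      have := abs_le.2 (hx.1 i)
      omega
    have hm : (x, μ, ν) ∈ plaquettes bc j :=
      plaquettes_zero_subset bc j (mem_plaquettes_zero_of_abs_lt hx.2 fun i => by
        have := habs i; dsimp only; omega)
    exact Finset.mem_map.2 ⟨⟨_, hm⟩, by simpa [deepPlaquettes] using habs, rfl⟩
  have := Finset.card_le_card h
  rw [Finset.card_product, card_piFinset_Icc, Finset.card_map] at this
  refine le_trans (le_of_eq ?_) this
  rw [mul_comm]
  congr 1

lemma partitionFunction_pos (bc : BoundaryCondition) (j : ℕ) {β : ℝ} (hβ : 0 < β) :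
    0 < partitionFunction bc j β := by
  rw [partitionFunction_eq, ← integral_gaussWeight_fluxMeasure _ hβ]
  exact integral_gaussWeight_fluxMeasure_pos _ hβ

/-- The bound on the logarithmic derivative in a finite box; the deep plaquettes contribute at
least `#deep - rank d - #deep / 4` to the sum of the squares of `‖δ_f - P δ_f‖²`. -/
lemma exists_hasDerivAt_log_partitionFunction {β δ : ℝ} (hβ : 0 < β) (hδ : 0 < δ) :
    ∃ R : ℕ, ∀ (bc : BoundaryCondition) (j : ℕ), ∃ L : ℝ,
      HasDerivAt (fun b : ℝ => Real.log (partitionFunction bc j b)) L β ∧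
      (R + 1 ≤ j → L ≤ -(3 * (2 * (j : ℝ) - 1) ^ 4 / (2 * β) +
        Real.pi ^ 2 / 6 * Real.exp (-Real.pi ^ 2 * (β + δ)) *
          (3 / 4 * (6 * (2 * ((j : ℝ) - R) + 1) ^ 4) -
            (4 * (2 * (j : ℝ) + 1) ^ 4 - (2 * (j : ℝ) - 1) ^ 4)))) := by
  have hε : 0 < δ / (2 * β) := by positivity
  obtain ⟨R, hR, hdeep⟩ := exists_norm_single_sub_extMap_sq_le hε
  refine ⟨R, fun bc j => ?_⟩
  classical
  obtain ⟨L, hL, hle⟩ := exists_hasDerivAt_log_integral_villainWeight (extMap bc j)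
    (exists_extMap_intCast bc j) hβ (deepPlaquettes bc j R) (η := 1 / 2 + δ / (2 * β))
    (fun f hf => hdeep bc j f (by simpa [deepPlaquettes] using hf)) le_rfl le_rfl
  refine ⟨L, by simpa only [partitionFunction_eq] using hL, fun hj => hle.trans ?_⟩
  have hcast : ((2 * j - 1 : ℕ) : ℝ) = 2 * (j : ℝ) - 1 := by
    push_cast [Nat.cast_sub (show 1 ≤ 2 * j by omega)]
    ring
  have hcast' : ((j - R : ℕ) : ℝ) = (j : ℝ) - R := Nat.cast_sub (by omega)
  have h1 : 3 * (2 * (j : ℝ) - 1) ^ 4 ≤ Module.finrank ℝ (LinearMap.range (extMap bc j)) := by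
    rw [← hcast]
    exact_mod_cast le_finrank_range_extMap bc j
  have h2 : (Module.finrank ℝ (LinearMap.range (extMap bc j)) : ℝ) ≤
      4 * (2 * (j : ℝ) + 1) ^ 4 - (2 * (j : ℝ) - 1) ^ 4 := by
    rw [← hcast, le_sub_iff_add_le]
    exact_mod_cast finrank_range_extMap_add_le bc j
  have h3 : 6 * (2 * ((j : ℝ) - R) + 1) ^ 4 ≤ (deepPlaquettes bc j R).card := by
    rw [← hcast']
    exact_mod_cast le_card_deepPlaquettes bc hR (by omega)
  have h4 : -(2 * Real.pi ^ 2 * β * (1 / 2 + δ / (2 * β))) = -Real.pi ^ 2 * (β + δ) := by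
    field_simp
  rw [h4]
  gcongr

/-- The finite-volume bounds have the limit `-(3/(8β) + (π²/16) exp (-π²(β+δ)))`, and `π²/16` exceeds
the constant `3/8` of the claim. -/
lemma limsup_deriv_log_partitionFunction_le {β δ : ℝ} (hβ : 0 < β) (hδ : 0 < δ)
    (bc : BoundaryCondition) :
    limsup (fun j : ℕ => ((1 / (4 * (2 * (j : ℝ)) ^ 4) *
        deriv (fun b : ℝ => Real.log (partitionFunction bc j b)) β : ℝ) : EReal)) atTop
      ≤ ((-(3 / 4) * (1 / (2 * β) + 1 / 2 * Real.exp (-Real.pi ^ 2 * (β + δ))) : ℝ) : EReal) := by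
  obtain ⟨R, hR⟩ := exists_hasDerivAt_log_partitionFunction hβ hδ
  choose L hL hle using hR bc
  set c := Real.exp (-Real.pi ^ 2 * (β + δ)) with hc
  have hc0 : 0 < c := Real.exp_pos _
  -- `u j` is the bound on the normalized derivative, written in terms of `1 / (2j) → 0`
  set u : ℝ → ℝ := fun t => -(1 / 4 * (3 * (1 - t) ^ 4 / (2 * β) + Real.pi ^ 2 / 6 * c *
    (3 / 4 * (6 * (1 + (1 - 2 * R) * t) ^ 4) - (4 * (1 + t) ^ 4 - (1 - t) ^ 4)))) with hu
  have ht : Tendsto (fun j : ℕ => 1 / (2 * (j : ℝ))) atTop (𝓝 0) :=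
    Tendsto.const_div_atTop ((tendsto_natCast_atTop_atTop).const_mul_atTop two_pos) _
  have hlim : Tendsto (fun j : ℕ => u (1 / (2 * (j : ℝ)))) atTop (𝓝 (u 0)) :=
    ((show Continuous u by fun_prop).tendsto 0).comp ht
  have hu0 : u 0 ≤ -(3 / 4) * (1 / (2 * β) + 1 / 2 * c) := by
    have hpi : 9 ≤ Real.pi ^ 2 := by nlinarith [Real.pi_gt_three]
    have h1 : u 0 = -(3 / 4) * (1 / (2 * β)) - Real.pi ^ 2 / 16 * c := by
      rw [hu]; ring
    rw [h1]
    nlinarith [mul_le_mul_of_nonneg_right hpi hc0.le]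
  have hlimE : Tendsto (fun j : ℕ => ((u (1 / (2 * (j : ℝ))) : ℝ) : EReal)) atTop
      (𝓝 ((u 0 : ℝ) : EReal)) := (continuous_coe_real_ereal.tendsto _).comp hlim
  refine le_trans ?_ (EReal.coe_le_coe_iff.2 hu0)
  rw [← hlimE.limsup_eq]
  refine limsup_le_limsup ?_
  filter_upwards [eventually_ge_atTop (R + 1)] with j hj
  rw [EReal.coe_le_coe_iff, (hL j).deriv]
  have hj0 : (0 : ℝ) < j := by exact_mod_cast (show 0 < j by omega)
  calc 1 / (4 * (2 * (j : ℝ)) ^ 4) * L j ≤ 1 / (4 * (2 * (j : ℝ)) ^ 4) * _ :=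
        mul_le_mul_of_nonneg_left (hle j hj) (by positivity)
    _ = u (1 / (2 * (j : ℝ))) := by
        rw [hu]
        field_simp
        ring

end VillainGauge

theorem theoremt (δ : ℝ) (hδ : 0 < δ) :
    ∃ β₀ : ℝ, 0 < β₀ ∧ ∀ β : ℝ, β₀ < β → ∀ bc : VillainGauge.BoundaryCondition,
      (∀ j : ℕ, 0 < VillainGauge.partitionFunction bc j β ∧
        DifferentiableAt ℝ (fun b : ℝ => Real.log (VillainGauge.partitionFunction bc j b)) β) ∧
      Filter.limsup
          (fun j : ℕ =>
            ((1 / (4 * (2 * (j : ℝ)) ^ 4) *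
              deriv (fun b : ℝ => Real.log (VillainGauge.partitionFunction bc j b)) β : ℝ) : EReal))
          Filter.atTop
        ≤ ((-(3 / 4) * (1 / (2 * β) + 1 / 2 * Real.exp (-Real.pi ^ 2 * (β + δ))) : ℝ) : EReal) := by
  -- the bound holds at every `β > 0`, so any `β₀` will do
  refine ⟨1, one_pos, fun β hβ1 bc => ?_⟩
  have hβ : 0 < β := one_pos.trans hβ1
  refine ⟨fun j => ⟨VillainGauge.partitionFunction_pos bc j hβ, ?_⟩,
    VillainGauge.limsup_deriv_log_partitionFunction_le hβ hδ bc⟩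
  obtain ⟨_, hR⟩ := VillainGauge.exists_hasDerivAt_log_partitionFunction hβ hδ
  obtain ⟨_, hL, _⟩ := hR bc j
  exact hL.differentiableAt
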